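/- Let $I,J\subset\mathbb R$ be open intervals (possibly unbounded), let $\Omega=I\times J$ with variables $(t,s)\in I\times J$, and let $v\in L^4(\Omega)$ be a real-valued distributional solution of Burgers' equation $$v_t+\Big(\frac{v^2}{2}\Big)_s=0\quad\text{in }\mathcal D'(\Omega)$$ which belongs to $L^3(I,W^{1/3,3}(J))$ in the sense that $$\int_I\int_{J\times J}\frac{|v(t,s)-v(t,\sigma)|^3}{|s-\sigma|^2}\,ds\,d\sigma\,dt<\infty .$$ Then $v$ satisfies the additional balance law $$\Big(\frac{v^2}{2}\Big)_t+\Big(\frac{v^3}{3}\Big)_s=0\quad\text{in }\mathcal D'(\Omega),$$ and $v$ is a locally bounded entropy solution of Burgers' equation; that is, $v\in L^\infty_{\rm loc}(\Omega)$, and for every pair of locally Lipschitz functions $\eta,q:\mathbb R\to\mathbb R$ such that $q'(w)=w\,\eta'(w)$ for a.e. $w\in\mathbb R$ and $\eta$ is convex, one has $$(\eta(v))_t+(q(v))_s\le 0\quad\text{in }\mathcal D'(\Omega),$$ i.e. $\int_\Omega\big(\eta(v)\,\varphi_t+q(v)\,\varphi_s\big)\,ds\,dt\ge 0$ for every $\varphi\in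 C_c^\infty(\Omega)$ with $\varphi\ge 0$. -/

import Mathlib

open MeasureTheory Set TopologicalSpace
open scoped Distributions ENNReal

noncomputable section

/-!
Points of the plane are pairs `(t, s)` (time, space). Test functions on an open set `Ω` are the
elements of `𝓓(Ω, ℝ)`: smooth functions with compact support contained in `Ω`.
-/

/-- The open rectangle `I × J`. -/
def rect (I J : Opens ℝ) : Opens (ℝ × ℝ) :=
  ⟨(I : Set ℝ) ×ˢ (J : Set ℝ), I.isOpen.prod J.isOpen⟩

/-- Action of the distribution `a_t + b_s` on a test function `φ`, up to the sign:
`∫_Ω (a φ_t + b φ_s)`, that is, `-⟨a_t + b_s, φ⟩`. -/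
def weakPairing (Ω : Opens (ℝ × ℝ)) (a b : ℝ × ℝ → ℝ) (φ : 𝓓(Ω, ℝ)) : ℝ :=
  ∫ z in (Ω : Set (ℝ × ℝ)), (a z * fderiv ℝ φ z (1, 0) + b z * fderiv ℝ φ z (0, 1))

/-- `a_t + b_s = 0` in the sense of distributions on `Ω`, for `a, b ∈ L¹_loc(Ω)`. -/
structure WeakBalance (Ω : Opens (ℝ × ℝ)) (a b : ℝ × ℝ → ℝ) : Prop where
  locallyIntegrable_fst : LocallyIntegrableOn a (Ω : Set (ℝ × ℝ))
  locallyIntegrable_snd : LocallyIntegrableOn b (Ω : Set (ℝ × ℝ))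
  eq_zero : ∀ φ : 𝓓(Ω, ℝ), weakPairing Ω a b φ = 0

/-- `a_t + b_s ≤ 0` in the sense of distributions on `Ω`, for `a, b ∈ L¹_loc(Ω)`:
`⟨a_t + b_s, φ⟩ ≤ 0` for every nonnegative test function `φ`. -/
structure WeakBalanceLE (Ω : Opens (ℝ × ℝ)) (a b : ℝ × ℝ → ℝ) : Prop where
  locallyIntegrable_fst : LocallyIntegrableOn a (Ω : Set (ℝ × ℝ))
  locallyIntegrable_snd : LocallyIntegrableOn b (Ω : Set (ℝ × ℝ))
  nonneg : ∀ φ : 𝓓(Ω, ℝ), (∀ z, 0 ≤ φ z) → 0 ≤ weakPairing Ω a b φ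

/-- `v` solves Burgers' equation `v_t + (v²/2)_s = 0` in the sense of distributions on `Ω`. -/
def IsBurgersSolution (Ω : Opens (ℝ × ℝ)) (v : ℝ × ℝ → ℝ) : Prop :=
  WeakBalance Ω v (fun z => v z ^ 2 / 2)

/-- `v ∈ L^∞_loc(Ω)`. -/
def MemLInftyLoc (Ω : Opens (ℝ × ℝ)) (v : ℝ × ℝ → ℝ) : Prop :=
  ∀ K : Set (ℝ × ℝ), IsCompact K → K ⊆ Ω → MemLp v ∞ (volume.restrict K)

/-- Entropy - entropy flux pairs for Burgers' equation. Locally Lipschitz functions are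
differentiable almost everywhere, so the derivatives below are genuine ones. -/
structure IsEntropyPair (η q : ℝ → ℝ) : Prop where
  entropy_lipschitz : LocallyLipschitz η
  flux_lipschitz : LocallyLipschitz q
  deriv_flux : ∀ᵐ w : ℝ, deriv q w = w * deriv η w

/-- Locally bounded entropy solutions of Burgers' equation on `Ω`. -/
structure IsEntropySolution (Ω : Opens (ℝ × ℝ)) (v : ℝ × ℝ → ℝ) : Prop where
  locallyBounded : MemLInftyLoc Ω v
  isSolution : IsBurgersSolution Ω v
  entropy_le : ∀ η q : ℝ → ℝ, IsEntropyPair η q → ConvexOn ℝ univ η →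
    WeakBalanceLE Ω (fun z => η (v z)) (fun z => q (v z))

/-- The cube of the `L³(I, W^{1/3,3}(J))` seminorm:
`∫_I ∫_{J×J} |v(t,s) - v(t,σ)|³ / |s - σ|² ds dσ dt`, with values in `[0, ∞]`. -/
def timeSpaceEnergy (I J : Set ℝ) (v : ℝ × ℝ → ℝ) : ℝ≥0∞ :=
  ∫⁻ t in I, ∫⁻ p in J ×ˢ J, ‖v (t, p.1) - v (t, p.2)‖ₑ ^ 3 / ‖p.1 - p.2‖ₑ ^ 2

end

/-!
Mollify `v` at scale `ε` in space and at a much finer scale in time. The mollified equation differs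
from Burgers' equation by the space derivative of half the variance of `v` under the kernel; tested
against a smooth entropy this error is cubic in the increments of `v`, and finiteness of the energy
provides scales along which it tends to zero. Hence every smooth entropy is conserved, which is the
kinetic formulation without dissipation: for each `ξ`, the indicator of `{v > ξ}` is transported
with constant speed `ξ`.

Consequently, if `(t, s)` is a generic point and the slope `σ / τ` is smaller than `v (t, s)`, then
also `v (t + τ, s + σ) > σ / τ`. If `|v|` were of order `M` or larger on a non-null set, shifting
that set by all vectors of slope in `(M, 2M)` and length at most `ρ` would make `|v| ≥ M` on a set
of area of order `ρ² / M`, whereas by Chebyshev's inequality this area is `O(M⁻²)`. So `v` is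
locally bounded, and the layer-cake formula writes `η(v)` and `q(v)` as superpositions of the
indicators of `{v > ξ}`, which yields all entropy balances with equality.
-/

section Increments

open Filter Topology

variable {E : Type*} [NormedAddCommGroup E] [MeasureSpace E]

/-- The integral over `K` of the `n`-th power of the increment of `u` by the vector `-w`. -/
noncomputable def increment (u : E → ℝ) (K : Set E) (n : ℕ) (w : E) : ℝ≥0∞ :=
  ∫⁻ z in K, ‖u (z - w) - u z‖ₑ ^ n

theorem increment_mono (u : E → ℝ) {K L : Set E} (hKL : K ⊆ L) (n : ℕ) (w : E) :
    increment u K n w ≤ increment u L n w :=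
  lintegral_mono_set hKL

section Measurability

variable [BorelSpace E] [SecondCountableTopology E]

theorem measurable_enorm_translate_sub {u : E → ℝ} (hu : Measurable u) :
    Measurable fun p : E × E => ‖u (p.2 - p.1) - u p.2‖ₑ :=
  ((hu.comp (measurable_snd.sub measurable_fst)).sub (hu.comp measurable_snd)).enorm

theorem measurable_increment [SFinite (volume : Measure E)] {u : E → ℝ} (hu : Measurable u)
    (K : Set E) (n : ℕ) : Measurable (increment u K n) :=
  ((measurable_enorm_translate_sub hu).pow_const n).lintegral_prod_right'

theorem increment_add_le [(volume : Measure E).IsAddRightInvariant] {u : E → ℝ}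
    (hu : Measurable u) (K : Set E) {n : ℕ} (hn : 1 ≤ n) (w₁ w₂ : E) :
    increment u K n (w₁ + w₂)
      ≤ 2 ^ (n - 1) * (increment u univ n w₁ + increment u K n w₂) := by
  have pow_add_le (a b : ℝ≥0∞) : (a + b) ^ n ≤ 2 ^ (n - 1) * (a ^ n + b ^ n) := by
    have := ENNReal.rpow_add_le_mul_rpow_add_rpow a b (p := n) (by exact_mod_cast hn)
    rw [← Nat.cast_pred (R := ℝ) hn] at this
    simpa only [ENNReal.rpow_natCast] using this
  have translate : ∫⁻ z, ‖u (z - w₂ - w₁) - u (z - w₂)‖ₑ ^ n = increment u univ n w₁ := by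
    rw [increment, Measure.restrict_univ]
    exact lintegral_sub_right_eq_self (fun z => ‖u (z - w₁) - u z‖ₑ ^ n) w₂
  calc increment u K n (w₁ + w₂)
      ≤ ∫⁻ z in K, 2 ^ (n - 1) * (‖u (z - w₂ - w₁) - u (z - w₂)‖ₑ ^ n
          + ‖u (z - w₂) - u z‖ₑ ^ n) := by
        refine lintegral_mono fun z => ?_
        rw [add_comm w₁, ← sub_sub, ← sub_add_sub_cancel (u (z - w₂ - w₁)) (u (z - w₂)) (u z)]
        exact (pow_le_pow_left₀ zero_le (enorm_add_le _ _) n).trans (pow_add_le _ _)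
    _ = 2 ^ (n - 1) * ((∫⁻ z in K, ‖u (z - w₂ - w₁) - u (z - w₂)‖ₑ ^ n)
          + increment u K n w₂) := by
        rw [lintegral_const_mul' _ _ (by finiteness), lintegral_add_right, increment]
        exact ((measurable_enorm_translate_sub hu).comp measurable_prodMk_left).pow_const n
    _ ≤ 2 ^ (n - 1) * (increment u univ n w₁ + increment u K n w₂) := by
        gcongr
        exact (setLIntegral_le_lintegral _ _).trans_eq translate

theorem tendsto_increment [LocallyCompactSpace E] [(volume : Measure E).IsAddHaarMeasure]
    {u : E → ℝ} {n : ℕ} (hn : 1 ≤ n) (hu : MemLp u n) (K : Set E) :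
    Tendsto (increment u K n) (𝓝 0) (𝓝 0) := by
  have hn0 : n ≠ 0 := by lia
  have : Fact ((1 : ℝ≥0∞) ≤ n) := ⟨by exact_mod_cast hn⟩
  let translation : C(E, C(E, E)) :=
    (ContinuousMap.mk (fun a : E × E => a.2 - a.1) (by fun_prop)).curry
  have translation_preserves (w : E) : MeasurePreserving (translation w) :=
    measurePreserving_sub_right volume w
  have continuous_translate : Continuous fun w =>
      Lp.compMeasurePreserving (translation w) (translation_preserves w) hu.toLp :=
    Continuous.compMeasurePreservingLp continuous_const translation.continuous
      translation_preserves (ENNReal.natCast_ne_top n)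
  have tendsto_edist_pow := ENNReal.Tendsto.pow (n := n)
    (tendsto_iff_edist_tendsto_0.1 (continuous_translate.tendsto 0))
  rw [zero_pow hn0] at tendsto_edist_pow
  refine tendsto_of_tendsto_of_tendsto_of_le_of_le tendsto_const_nhds tendsto_edist_pow
    (fun _ => zero_le) fun w => (increment_mono u (subset_univ K) n w).trans_eq ?_
  rw [increment, Measure.restrict_univ, Lp.edist_def,
    eLpNorm_eq_lintegral_rpow_enorm_toReal (by simpa using hn0) (ENNReal.natCast_ne_top n),
    ← ENNReal.rpow_natCast, ← ENNReal.rpow_mul, ENNReal.toReal_natCast,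
    one_div_mul_cancel (Nat.cast_ne_zero.2 hn0), ENNReal.rpow_one]
  refine lintegral_congr_ae ?_
  have coeFn_translate (w : E) :
      Lp.compMeasurePreserving (translation w) (translation_preserves w) hu.toLp
        =ᵐ[volume] fun z => u (z - w) :=
    (Lp.coeFn_compMeasurePreserving _ _).trans
      ((translation_preserves w).quasiMeasurePreserving.ae_eq_comp hu.coeFn_toLp)
  filter_upwards [coeFn_translate w, coeFn_translate 0] with z hw h0
  simp only [Pi.sub_apply, hw, h0, sub_zero, ENNReal.rpow_natCast]

end Measurability

end Increments

section Mollification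

open Filter Topology
open scoped Convolution ContDiff

variable {E : Type*} [NormedAddCommGroup E] [NormedSpace ℝ E] [MeasureSpace E]

theorem integrable_fderiv_apply [OpensMeasurableSpace E]
    [IsFiniteMeasureOnCompacts (volume : Measure E)] {g : E → ℝ} (hg : ContDiff ℝ 1 g)
    (hgc : HasCompactSupport g) (e : E) : Integrable fun z => fderiv ℝ g z e :=
  ((hg.continuous_fderiv one_ne_zero).clm_apply continuous_const).integrable_of_hasCompactSupport
    (hgc.fderiv_apply (𝕜 := ℝ) e)

/-- The difference `∫ u² dν - (∫ u dν)²` for the measure `ν = k(z - ·)`. When `k` is a probability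
density, this is the variance of `u` under `ν`, and half of it is the defect by which `u ⋆ k` fails
to solve Burgers' equation when `u` does. -/
noncomputable def kernelVariance (u k : E → ℝ) (z : E) : ℝ :=
  (u ^ 2 ⋆ k) z - (u ⋆ k) z ^ 2

/-- Smooth probability densities supported in `B` and bounded by `c` times the uniform density. -/
structure IsMollifier (k : E → ℝ) (B : Set E) (c : ℝ) : Prop where
  contDiff : ContDiff ℝ ∞ k
  hasCompactSupport : HasCompactSupport k
  tsupport_subset : tsupport k ⊆ B
  nonneg : ∀ w, 0 ≤ k w
  integral_eq_one : ∫ w, k w = 1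
  abs_le : ∀ w, |k w| ≤ c / volume.real B

theorem IsMollifier.support_subset {k : E → ℝ} {B : Set E} {c : ℝ} (hk : IsMollifier k B c) :
    Function.support k ⊆ B :=
  (subset_tsupport k).trans hk.tsupport_subset

variable [FiniteDimensional ℝ E] [BorelSpace E] [(volume : Measure E).IsAddHaarMeasure]

theorem integral_fderiv_apply_eq_zero {g : E → ℝ} (hg : ContDiff ℝ 1 g)
    (hgc : HasCompactSupport g) (e : E) : ∫ z, fderiv ℝ g z e = 0 := by
  have := integral_mul_fderiv_eq_neg_fderiv_mul_of_integrable (μ := (volume : Measure E))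
    (f := fun _ => (1 : ℝ)) (g := g) (v := e) (by simp)
    (by simpa using integrable_fderiv_apply hg hgc e)
    (by simpa using hg.continuous.integrable_of_hasCompactSupport hgc)
    (fun x _ => by fun_prop) (fun x _ => (hg.differentiable one_ne_zero).differentiableAt)
  simpa using this

theorem fderiv_convolution_apply {f k : E → ℝ} (hf : LocallyIntegrable f) (hk : ContDiff ℝ 1 k)
    (hkc : HasCompactSupport k) (z e : E) :
    fderiv ℝ (f ⋆ k) z e = (f ⋆ fun w => fderiv ℝ k w e) z := by
  rw [(hkc.hasFDerivAt_convolution_right _ hf hk z).fderiv,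
    convolution_precompR_apply _ hf (hkc.fderiv ℝ) (hk.continuous_fderiv one_ne_zero)]

theorem integrable_translate_mul {f k : E → ℝ} (hf : LocallyIntegrable f) (hk : Continuous k)
    (hkc : HasCompactSupport k) (z : E) : Integrable fun w => f (z - w) * k w :=
  (hkc.convolutionExists_right (ContinuousLinearMap.lsmul ℝ ℝ) hf hk z).integrable_swap

theorem integral_translate_sub_mul {f k : E → ℝ} (hf : LocallyIntegrable f) (hk : Continuous k)
    (hkc : HasCompactSupport k) (z : E) (a : ℝ) :
    ∫ w, (f (z - w) - a) * k w = (f ⋆ k) z - a * ∫ w, k w := by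
  simp_rw [sub_mul]
  rw [integral_sub (integrable_translate_mul hf hk hkc z)
      ((hk.integrable_of_hasCompactSupport hkc).const_mul a),
    integral_const_mul, convolution_lsmul_swap]
  rfl

theorem enorm_integral_mul_le_setLAverage {X : Type*} [MeasurableSpace X] {μ : Measure X}
    {k : X → ℝ} {B : Set X} {c : ℝ} (hkB : Function.support k ⊆ B)
    (hkc : ∀ w, |k w| ≤ c / μ.real B) (g : X → ℝ) :
    ‖∫ w, g w * k w ∂μ‖ₑ ≤ ENNReal.ofReal c * ⨍⁻ w in B, ‖g w‖ₑ ∂μ := by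
  calc ‖∫ w, g w * k w ∂μ‖ₑ = ‖∫ w in B, g w * k w ∂μ‖ₑ := by
        rw [setIntegral_eq_integral_of_forall_compl_eq_zero fun w hw => ?_]
        rw [Function.notMem_support.1 fun h => hw (hkB h), mul_zero]
    _ ≤ ∫⁻ w in B, ENNReal.ofReal (c / μ.real B) * ‖g w‖ₑ ∂μ := by
        refine (enorm_integral_le_lintegral_enorm _).trans (lintegral_mono fun w => ?_)
        rw [enorm_mul, mul_comm, Real.enorm_eq_ofReal_abs (k w)]
        gcongr
        exact hkc w
    _ = ENNReal.ofReal (c / μ.real B) * ∫⁻ w in B, ‖g w‖ₑ ∂μ :=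
        lintegral_const_mul' _ _ ENNReal.ofReal_ne_top
    _ ≤ ENNReal.ofReal c * ⨍⁻ w in B, ‖g w‖ₑ ∂μ := by
        rcases (measureReal_nonneg (μ := μ) (s := B)).eq_or_lt with h0 | hpos
        · rw [← h0, div_zero, ENNReal.ofReal_zero, zero_mul]
          exact zero_le
        · have hB : μ B ≠ ⊤ := fun h => hpos.ne' (by simp [Measure.real, h])
          rw [ENNReal.ofReal_div_of_pos hpos, ofReal_measureReal hB, setLAverage_eq,
            ENNReal.div_eq_inv_mul, ENNReal.div_eq_inv_mul, mul_left_comm, mul_assoc]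

namespace IsMollifier

variable {k u : E → ℝ} {B : Set E} {c : ℝ}

theorem enorm_convolution_sub_le (hk : IsMollifier k B c) (hu : LocallyIntegrable u) (z : E) :
    ‖(u ⋆ k) z - u z‖ₑ ≤ ENNReal.ofReal c * ⨍⁻ w in B, ‖u (z - w) - u z‖ₑ ∂volume := by
  have := integral_translate_sub_mul hu hk.contDiff.continuous hk.hasCompactSupport z (u z)
  rw [hk.integral_eq_one, mul_one] at this
  rw [← this]
  exact enorm_integral_mul_le_setLAverage hk.support_subset hk.abs_le _

theorem enorm_fderiv_convolution_le (hk : IsMollifier k B c) (hu : LocallyIntegrable u) {e : E}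
    {c' : ℝ} (hk' : ∀ w, |fderiv ℝ k w e| ≤ c' / volume.real B) (z : E) :
    ‖fderiv ℝ (u ⋆ k) z e‖ₑ ≤ ENNReal.ofReal c' * ⨍⁻ w in B, ‖u (z - w) - u z‖ₑ ∂volume := by
  have hk1 : ContDiff ℝ 1 k := hk.contDiff.of_le (by simp)
  have := integral_translate_sub_mul hu
    ((hk1.continuous_fderiv one_ne_zero).clm_apply continuous_const)
    (hk.hasCompactSupport.fderiv_apply (𝕜 := ℝ) e) z (u z)
  rw [integral_fderiv_apply_eq_zero hk1 hk.hasCompactSupport, mul_zero, sub_zero] at this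
  rw [fderiv_convolution_apply hu hk1 hk.hasCompactSupport, ← this]
  refine enorm_integral_mul_le_setLAverage (fun w hw => hk.tsupport_subset ?_) hk' _
  exact tsupport_fderiv_apply_subset ℝ e (subset_tsupport _ hw)

theorem integral_translate_sub_sq_mul (hk : IsMollifier k B c) (hu : LocallyIntegrable u)
    (hu2 : LocallyIntegrable (u ^ 2)) (z : E) (a : ℝ) :
    ∫ w, (u (z - w) - a) ^ 2 * k w = kernelVariance u k z + ((u ⋆ k) z - a) ^ 2 := by
  have hkcont := hk.contDiff.continuous
  have i₁ := integrable_translate_mul hu hkcont hk.hasCompactSupport z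
  have i₂ := integrable_translate_mul hu2 hkcont hk.hasCompactSupport z
  have i₀ := hkcont.integrable_of_hasCompactSupport (μ := volume) hk.hasCompactSupport
  have i₂₁ : Integrable fun w => (u ^ 2) (z - w) * k w - 2 * a * (u (z - w) * k w) :=
    i₂.sub (i₁.const_mul _)
  calc ∫ w, (u (z - w) - a) ^ 2 * k w
      = ∫ w, (u ^ 2) (z - w) * k w - 2 * a * (u (z - w) * k w) + a ^ 2 * k w := by
        refine integral_congr_ae (.of_forall fun w => ?_)
        simp only [Pi.pow_apply]
        ring
    _ = (u ^ 2 ⋆ k) z - 2 * a * (u ⋆ k) z + a ^ 2 := by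
        rw [integral_add i₂₁ (i₀.const_mul _), integral_sub i₂ (i₁.const_mul _),
          integral_const_mul, integral_const_mul, hk.integral_eq_one, convolution_lsmul_swap,
          convolution_lsmul_swap, mul_one]
        rfl
    _ = kernelVariance u k z + ((u ⋆ k) z - a) ^ 2 := by
        rw [kernelVariance]
        ring

theorem enorm_kernelVariance_le (hk : IsMollifier k B c) (hu : LocallyIntegrable u)
    (hu2 : LocallyIntegrable (u ^ 2)) (z : E) :
    ‖kernelVariance u k z‖ₑ ≤ ENNReal.ofReal c * ⨍⁻ w in B, ‖u (z - w) - u z‖ₑ ^ 2 ∂volume := by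
  have expand := hk.integral_translate_sub_sq_mul hu hu2 z
  have nonneg : 0 ≤ kernelVariance u k z := by
    have : 0 ≤ ∫ w, (u (z - w) - (u ⋆ k) z) ^ 2 * k w :=
      integral_nonneg fun w => mul_nonneg (sq_nonneg _) (hk.nonneg w)
    simpa only [expand, sub_self, ne_eq, OfNat.ofNat_ne_zero, not_false_eq_true, zero_pow,
      add_zero] using this
  have le_moment : kernelVariance u k z ≤ ∫ w, (u (z - w) - u z) ^ 2 * k w := by
    rw [expand]
    exact le_add_of_nonneg_right (sq_nonneg _)
  calc ‖kernelVariance u k z‖ₑ ≤ ‖∫ w, (u (z - w) - u z) ^ 2 * k w‖ₑ := by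
        rw [Real.enorm_of_nonneg nonneg, Real.enorm_of_nonneg (nonneg.trans le_moment)]
        exact ENNReal.ofReal_le_ofReal le_moment
    _ ≤ ENNReal.ofReal c * ⨍⁻ w in B, ‖(u (z - w) - u z) ^ 2‖ₑ ∂volume :=
        enorm_integral_mul_le_setLAverage hk.support_subset hk.abs_le _
    _ = ENNReal.ofReal c * ⨍⁻ w in B, ‖u (z - w) - u z‖ₑ ^ 2 ∂volume := by simp_rw [enorm_pow]

end IsMollifier

theorem lintegral_mul_lintegral_sq_le {X : Type*} [MeasurableSpace X] {μ : Measure X}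
    [IsZeroOrProbabilityMeasure μ] {a : X → ℝ≥0∞} (ha : Measurable a) :
    (∫⁻ x, a x ∂μ) * ∫⁻ x, a x ^ 2 ∂μ ≤ 2 * ∫⁻ x, a x ^ 3 ∂μ := by
  have mul_sq_le (x y : ℝ≥0∞) : x * y ^ 2 ≤ x ^ 3 + y ^ 3 := by
    rcases le_total x y with h | h
    · exact (mul_le_mul_left h _).trans ((pow_succ' y 2).ge.trans le_add_self)
    · exact (mul_le_mul_right (pow_le_pow_left₀ zero_le h 2) _).trans
        ((pow_succ' x 2).ge.trans le_self_add)
  calc (∫⁻ x, a x ∂μ) * ∫⁻ x, a x ^ 2 ∂μ = ∫⁻ x, ∫⁻ y, a x * a y ^ 2 ∂μ ∂μ := by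
        rw [← lintegral_mul_const _ ha]
        exact lintegral_congr fun x => (lintegral_const_mul _ (ha.pow_const 2)).symm
    _ ≤ ∫⁻ x, ∫⁻ y, a x ^ 3 + a y ^ 3 ∂μ ∂μ := by
        gcongr
        exact mul_sq_le _ _
    _ = (∫⁻ x, a x ^ 3 ∂μ) * μ univ + (∫⁻ x, a x ^ 3 ∂μ) * μ univ := by
        simp_rw [lintegral_add_left measurable_const, lintegral_const]
        rw [lintegral_add_right _ measurable_const, lintegral_mul_const _ (ha.pow_const 3),
          lintegral_const]
    _ ≤ 2 * ∫⁻ x, a x ^ 3 ∂μ := by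
        rw [two_mul]
        gcongr <;> exact mul_le_of_le_one_right' prob_le_one

section IntegratedErrors

variable {k u : E → ℝ} {B : Set E} {c : ℝ}

theorem lintegral_setLAverage_enorm_translate_sub (hu : Measurable u) (K B : Set E) (n : ℕ) :
    ∫⁻ z in K, ⨍⁻ w in B, ‖u (z - w) - u z‖ₑ ^ n ∂volume = ⨍⁻ w in B, increment u K n w ∂volume :=
  lintegral_lintegral_swap
    (((measurable_enorm_translate_sub hu).comp measurable_swap).pow_const n).aemeasurable

theorem IsMollifier.lintegral_enorm_convolution_sub_le (hk : IsMollifier k B c)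
    (hum : Measurable u) (hu : LocallyIntegrable u) (K : Set E) :
    ∫⁻ z in K, ‖(u ⋆ k) z - u z‖ₑ ≤ ENNReal.ofReal c * ⨍⁻ w in B, increment u K 1 w ∂volume := by
  rw [← lintegral_setLAverage_enorm_translate_sub hum, ← lintegral_const_mul' _ _ (by simp)]
  simp_rw [pow_one]
  exact lintegral_mono (hk.enorm_convolution_sub_le hu)

theorem IsMollifier.lintegral_enorm_kernelVariance_le (hk : IsMollifier k B c)
    (hum : Measurable u) (hu : LocallyIntegrable u) (hu2 : LocallyIntegrable (u ^ 2))
    (K : Set E) :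
    ∫⁻ z in K, ‖kernelVariance u k z‖ₑ
      ≤ ENNReal.ofReal c * ⨍⁻ w in B, increment u K 2 w ∂volume := by
  rw [← lintegral_setLAverage_enorm_translate_sub hum, ← lintegral_const_mul' _ _ (by simp)]
  exact lintegral_mono (hk.enorm_kernelVariance_le hu hu2)

theorem IsMollifier.lintegral_enorm_kernelVariance_mul_fderiv_le (hk : IsMollifier k B c)
    (hum : Measurable u) (hu : LocallyIntegrable u) (hu2 : LocallyIntegrable (u ^ 2)) {e : E}
    {c' : ℝ} (hk' : ∀ w, |fderiv ℝ k w e| ≤ c' / volume.real B) (K : Set E) :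
    ∫⁻ z in K, ‖kernelVariance u k z‖ₑ * ‖fderiv ℝ (u ⋆ k) z e‖ₑ
      ≤ 2 * ENNReal.ofReal c * ENNReal.ofReal c' * ⨍⁻ w in B, increment u K 3 w ∂volume := by
  rw [← lintegral_setLAverage_enorm_translate_sub hum,
    ← lintegral_const_mul' _ _ (by finiteness)]
  refine lintegral_mono fun z => ?_
  have hz : Measurable fun w => ‖u (z - w) - u z‖ₑ :=
    (measurable_enorm_translate_sub hum).comp measurable_prodMk_right
  calc ‖kernelVariance u k z‖ₑ * ‖fderiv ℝ (u ⋆ k) z e‖ₑ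
      ≤ (ENNReal.ofReal c * ⨍⁻ w in B, ‖u (z - w) - u z‖ₑ ^ 2 ∂volume)
          * (ENNReal.ofReal c' * ⨍⁻ w in B, ‖u (z - w) - u z‖ₑ ∂volume) :=
        mul_le_mul' (hk.enorm_kernelVariance_le hu hu2 z)
          (hk.enorm_fderiv_convolution_le hu hk' z)
    _ = ENNReal.ofReal c * ENNReal.ofReal c' * ((⨍⁻ w in B, ‖u (z - w) - u z‖ₑ ∂volume)
          * ⨍⁻ w in B, ‖u (z - w) - u z‖ₑ ^ 2 ∂volume) := by ring
    _ ≤ ENNReal.ofReal c * ENNReal.ofReal c' * (2 * ⨍⁻ w in B, ‖u (z - w) - u z‖ₑ ^ 3 ∂volume) :=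
        mul_le_mul_right (lintegral_mul_lintegral_sq_le hz) _
    _ = 2 * ENNReal.ofReal c * ENNReal.ofReal c' * ⨍⁻ w in B, ‖u (z - w) - u z‖ₑ ^ 3 ∂volume := by
        ring

end IntegratedErrors

end Mollification

section Kernel

open scoped ContDiff Pointwise

variable {E : Type*} [NormedAddCommGroup E] [NormedSpace ℝ E]

theorem fderiv_mul_snd_apply {F : Type*} [NormedAddCommGroup F] [NormedSpace ℝ F]
    {k : E → ℝ} {l : F → ℝ} {w : E × F} (hk : DifferentiableAt ℝ k w.1)
    (hl : DifferentiableAt ℝ l w.2) (e : F) :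
    fderiv ℝ (fun w : E × F => k w.1 * l w.2) w (0, e) = k w.1 * fderiv ℝ l w.2 e := by
  have hk' := hk.hasFDerivAt.comp w hasFDerivAt_fst
  have hl' := hl.hasFDerivAt.comp w hasFDerivAt_snd
  have : HasFDerivAt (fun w : E × F => k w.1 * l w.2) _ w := hk'.mul hl'
  simp [this.fderiv]

variable [MeasureSpace E]

theorem IsMollifier.prod {F : Type*} [NormedAddCommGroup F] [NormedSpace ℝ F] [MeasureSpace F]
    [SFinite (volume : Measure E)] [SFinite (volume : Measure F)]
    {k : E → ℝ} {l : F → ℝ} {B : Set E} {B' : Set F} {c c' : ℝ} (hk : IsMollifier k B c)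
    (hl : IsMollifier l B' c') :
    IsMollifier (fun w : E × F => k w.1 * l w.2) (B ×ˢ B') (c * c') := by
  have tsupport_subset : tsupport (fun w : E × F => k w.1 * l w.2) ⊆ tsupport k ×ˢ tsupport l := by
    refine closure_minimal (fun w hw => ?_) ((isClosed_tsupport k).prod (isClosed_tsupport l))
    exact ⟨subset_tsupport k (left_ne_zero_of_mul hw), subset_tsupport l (right_ne_zero_of_mul hw)⟩
  exact {
    contDiff := (hk.contDiff.comp contDiff_fst).mul (hl.contDiff.comp contDiff_snd)
    hasCompactSupport := (hk.hasCompactSupport.prod hl.hasCompactSupport).of_isClosed_subset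
      (isClosed_tsupport _) tsupport_subset
    tsupport_subset := tsupport_subset.trans (prod_mono hk.tsupport_subset hl.tsupport_subset)
    nonneg := fun w => mul_nonneg (hk.nonneg w.1) (hl.nonneg w.2)
    integral_eq_one := by
      rw [Measure.volume_eq_prod, integral_prod_mul, hk.integral_eq_one, hl.integral_eq_one,
        mul_one]
    abs_le := fun w => by
      rw [abs_mul, Measure.volume_eq_prod, measureReal_prod_prod, ← div_mul_div_comm]
      exact mul_le_mul (hk.abs_le w.1) (hl.abs_le w.2) (abs_nonneg _)
        ((abs_nonneg _).trans (hk.abs_le w.1)) }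

variable [FiniteDimensional ℝ E] [BorelSpace E] [(volume : Measure E).IsAddHaarMeasure]

theorem IsMollifier.rescale {k : E → ℝ} {B : Set E} {c : ℝ} (hk : IsMollifier k B c) {r : ℝ}
    (hr : 0 < r) :
    IsMollifier (fun w => (r ^ Module.finrank ℝ E)⁻¹ * k (r⁻¹ • w)) (r • B) c where
  contDiff := contDiff_const.mul (hk.contDiff.comp (contDiff_const_smul _))
  hasCompactSupport := (hk.hasCompactSupport.comp_smul (inv_ne_zero hr.ne')).mul_left
  tsupport_subset := by
    have : tsupport (fun w => k (r⁻¹ • w)) = (r⁻¹ • ·) ⁻¹' tsupport k :=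
      tsupport_comp_eq_preimage k (Homeomorph.smulOfNeZero r⁻¹ (inv_ne_zero hr.ne'))
    refine (tsupport_mul_subset_right).trans ?_
    rw [this, preimage_smul_inv₀ hr.ne']
    exact smul_set_mono hk.tsupport_subset
  nonneg w := mul_nonneg (by positivity) (hk.nonneg _)
  integral_eq_one := by
    rw [integral_const_mul, Measure.integral_comp_inv_smul_of_nonneg _ _ hr.le, hk.integral_eq_one,
      smul_eq_mul, mul_one, inv_mul_cancel₀ (by positivity)]
  abs_le w := by
    rw [abs_mul, abs_of_nonneg (by positivity), measureReal_def,
      Measure.addHaar_smul_of_nonneg _ hr.le, ENNReal.toReal_mul,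
      ENNReal.toReal_ofReal (by positivity), ← measureReal_def, div_mul_eq_div_div_swap,
      ← div_eq_inv_mul]
    gcongr
    exact hk.abs_le _

theorem abs_fderiv_rescale_le {k : E → ℝ} (hk : Differentiable ℝ k) {B : Set E} {c : ℝ} {e : E}
    (hk' : ∀ w, |fderiv ℝ k w e| ≤ c / volume.real B) {r : ℝ} (hr : 0 < r) (w : E) :
    |fderiv ℝ (fun w => (r ^ Module.finrank ℝ E)⁻¹ * k (r⁻¹ • w)) w e|
      ≤ c / r / volume.real (r • B) := by
  rw [fderiv_const_mul (by fun_prop), fderiv_comp_smul, smul_apply, smul_apply, smul_eq_mul,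
    smul_eq_mul, measureReal_def, Measure.addHaar_smul_of_nonneg _ hr.le, ENNReal.toReal_mul,
    ENNReal.toReal_ofReal (by positivity), ← measureReal_def, abs_mul, abs_mul,
    abs_of_nonneg (by positivity), abs_of_nonneg (by positivity)]
  calc (r ^ Module.finrank ℝ E)⁻¹ * (r⁻¹ * |fderiv ℝ k (r⁻¹ • w) e|)
      ≤ (r ^ Module.finrank ℝ E)⁻¹ * (r⁻¹ * (c / volume.real B)) := by
        gcongr
        exact hk' _
    _ = c / r / (r ^ Module.finrank ℝ E * volume.real B) := by ring

theorem exists_isMollifier_closedBall_one (e : E) : ∃ C > 0, ∃ k : E → ℝ,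
    IsMollifier k (Metric.closedBall 0 1) C ∧
      ∀ w, |fderiv ℝ k w e| ≤ C / volume.real (Metric.closedBall (0 : E) 1) := by
  let b : ContDiffBump (0 : E) := ⟨1 / 2, 1, by norm_num, by norm_num⟩
  have hb : ContDiff ℝ 1 (b.normed volume) := b.contDiff_normed
  obtain ⟨C₁, hC₁⟩ := hb.continuous.bounded_above_of_compact_support b.hasCompactSupport_normed
  obtain ⟨C₂, hC₂⟩ := ((hb.continuous_fderiv one_ne_zero).clm_apply
    continuous_const).bounded_above_of_compact_support
      (b.hasCompactSupport_normed.fderiv_apply (𝕜 := ℝ) e)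
  have hvol : 0 < volume.real (Metric.closedBall (0 : E) 1) :=
    ENNReal.toReal_pos (Metric.measure_closedBall_pos volume 0 one_pos).ne'
      measure_closedBall_lt_top.ne
  set M := max (max C₁ C₂) 1
  have hM : 0 < M := zero_lt_one.trans_le (le_max_right _ _)
  refine ⟨M * volume.real (Metric.closedBall (0 : E) 1), mul_pos hM hvol, b.normed volume,
    ⟨b.contDiff_normed, b.hasCompactSupport_normed, b.tsupport_normed_eq.subset, b.nonneg_normed,
      b.integral_normed, fun w => ?_⟩, fun w => ?_⟩
  · rw [mul_div_cancel_right₀ _ hvol.ne']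
    exact (hC₁ w).trans ((le_max_left _ _).trans (le_max_left _ _))
  · rw [mul_div_cancel_right₀ _ hvol.ne']
    exact (hC₂ w).trans ((le_max_right _ _).trans (le_max_left _ _))

/-- The rectangle `[-δ, δ] × [-ε, ε]` over which mollification averages. The time scale `δ` and the
space scale `ε` are chosen independently, since regularity is only available in space. -/
def box (δ ε : ℝ) : Set (ℝ × ℝ) := Icc (-δ) δ ×ˢ Icc (-ε) ε

theorem isCompact_box (δ ε : ℝ) : IsCompact (box δ ε) := isCompact_Icc.prod isCompact_Icc

theorem measurableSet_box (δ ε : ℝ) : MeasurableSet (box δ ε) :=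
  (isCompact_box δ ε).measurableSet

theorem box_subset_closedBall {δ ε r : ℝ} (hδ : δ ≤ r) (hε : ε ≤ r) :
    box δ ε ⊆ Metric.closedBall 0 r := fun _ hw =>
  mem_closedBall_zero_iff.2 (max_le ((abs_le.2 hw.1).trans hδ) ((abs_le.2 hw.2).trans hε))

theorem exists_isMollifier_box : ∃ C > 0, ∀ δ > 0, ∀ ε > 0, ∃ k : ℝ × ℝ → ℝ,
    IsMollifier k (box δ ε) C ∧ ∀ w, |fderiv ℝ k w (0, 1)| ≤ C / ε / volume.real (box δ ε) := by
  obtain ⟨C, hC, ρ, hρ, hρ'⟩ := exists_isMollifier_closedBall_one (1 : ℝ)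
  have smul_closedBall {r : ℝ} (hr : 0 < r) : r • Metric.closedBall (0 : ℝ) 1 = Icc (-r) r := by
    rw [_root_.smul_closedBall' hr.ne', Real.closedBall_eq_Icc]
    simp [abs_of_pos hr]
  refine ⟨C * C, mul_pos hC hC, fun δ hδ ε hε => ?_⟩
  have hρδ := hρ.rescale hδ
  have hρε := hρ.rescale hε
  have hρε' := abs_fderiv_rescale_le (hρ.contDiff.differentiable (by simp)) hρ' hε
  rw [smul_closedBall hδ] at hρδ
  rw [smul_closedBall hε] at hρε hρε'
  refine ⟨_, hρδ.prod hρε, fun w => ?_⟩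
  rw [fderiv_mul_snd_apply (hρδ.contDiff.differentiable (by simp) _)
      (hρε.contDiff.differentiable (by simp) _), abs_mul, box, Measure.volume_eq_prod,
    measureReal_prod_prod, mul_div_assoc, ← div_mul_div_comm]
  exact mul_le_mul (hρδ.abs_le w.1) (hρε' w.2) (abs_nonneg _)
    ((abs_nonneg _).trans (hρδ.abs_le w.1))

end Kernel

section ScaleSelection

open Filter Topology

theorem setLAverage_le_of_forall_mem_le {X : Type*} [MeasurableSpace X] {μ : Measure X} {s : Set X}
    (hs : MeasurableSet s) {f : X → ℝ≥0∞} {c : ℝ≥0∞} (h : ∀ x ∈ s, f x ≤ c) :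
    ⨍⁻ x in s, f x ∂μ ≤ c := by
  rw [setLAverage_eq]
  refine ENNReal.div_le_of_le_mul ?_
  rw [← setLIntegral_const]
  exact setLIntegral_mono' hs h

theorem setLAverage_prod_snd {X Y : Type*} [MeasurableSpace X] [MeasurableSpace Y] {μ : Measure X}
    {ν : Measure Y} [SFinite μ] [SFinite ν] {A : Set X} (hA₀ : μ A ≠ 0) (hA : μ A ≠ ⊤) (B : Set Y)
    {f : Y → ℝ≥0∞} (hf : Measurable f) :
    ⨍⁻ p in A ×ˢ B, f p.2 ∂μ.prod ν = ⨍⁻ y in B, f y ∂ν := by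
  rw [setLAverage_eq, setLAverage_eq, ← Measure.prod_restrict,
    ← lintegral_map hf measurable_snd, Measure.map_snd_prod, lintegral_smul_measure, smul_eq_mul,
    Measure.restrict_apply_univ, Measure.prod_prod, ENNReal.mul_div_mul_left _ _ hA₀ hA]

theorem tendsto_setLIntegral_Icc_neg_self {f : ℝ → ℝ≥0∞} {r : ℝ} (hr : 0 < r)
    (hf : ∫⁻ y in Icc (-r) r, f y ≠ ⊤) :
    Tendsto (fun ε => ∫⁻ y in Icc (-ε) ε, f y) (𝓝[>] 0) (𝓝 0) := by
  have tendsto_volume : Tendsto (fun ε : ℝ => volume (Icc (-ε) ε)) (𝓝[>] 0) (𝓝 0) := by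
    have : Continuous fun ε : ℝ => ENNReal.ofReal (ε - -ε) :=
      ENNReal.continuous_ofReal.comp (by fun_prop)
    simpa only [Real.volume_Icc, neg_zero, sub_zero, ENNReal.ofReal_zero]
      using (this.tendsto 0).mono_left nhdsWithin_le_nhds
  refine (tendsto_setLIntegral_zero hf (tendsto_of_tendsto_of_tendsto_of_le_of_le
    tendsto_const_nhds tendsto_volume (fun _ => zero_le)
    fun _ => Measure.restrict_apply_le _ _)).congr' ?_
  filter_upwards [Ioc_mem_nhdsGT hr] with ε hε
  rw [Measure.restrict_restrict measurableSet_Icc,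
    inter_eq_left.2 (Icc_subset_Icc (neg_le_neg hε.2) hε.2)]

theorem setLAverage_Icc_le_mul_lintegral_div_sq (N : ℝ → ℝ≥0∞) {ε : ℝ} (hε : 0 < ε) :
    ⨍⁻ y in Icc (-ε) ε, N y ∂volume
      ≤ ENNReal.ofReal ε * ∫⁻ y in Icc (-ε) ε, N y / ‖y‖ₑ ^ 2 := by
  rw [setLAverage_eq, Real.volume_Icc]
  refine ENNReal.div_le_of_le_mul ?_
  rw [mul_right_comm, ← ENNReal.ofReal_mul hε.le, ← lintegral_const_mul' _ _ ENNReal.ofReal_ne_top]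
  refine lintegral_mono_ae ?_
  filter_upwards [ae_restrict_mem measurableSet_Icc, Measure.ae_ne _ (0 : ℝ)] with y hy hy0
  calc N y = ‖y‖ₑ ^ 2 * (N y / ‖y‖ₑ ^ 2) :=
        (ENNReal.mul_div_cancel (by simpa using hy0) (by finiteness)).symm
    _ ≤ ENNReal.ofReal (ε * (ε - -ε)) * (N y / ‖y‖ₑ ^ 2) := by
        rw [Real.enorm_eq_ofReal_abs, ← ENNReal.ofReal_pow (abs_nonneg _)]
        gcongr
        nlinarith [abs_le.2 hy, abs_nonneg y]

/-- The part of the cubed `L³_t W^{1/3,3}_s` seminorm of `v` carried by pairs of points `(t, s)`,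
`(t, s - y)` with `(t, s) ∈ K` and `|y| ≤ r`. -/
noncomputable def spatialEnergy (v : ℝ × ℝ → ℝ) (K : Set (ℝ × ℝ)) (r : ℝ) : ℝ≥0∞ :=
  ∫⁻ y in Icc (-r) r, increment v K 3 (0, y) / ‖y‖ₑ ^ 2

theorem setLAverage_box_increment_le {u : ℝ × ℝ → ℝ} (hu : Measurable u) (K : Set (ℝ × ℝ))
    {δ ε : ℝ} (hδ : 0 < δ) (hε : 0 < ε) {b : ℝ≥0∞}
    (hb : ∀ τ ∈ Icc (-δ) δ, increment u univ 3 (τ, 0) ≤ b) :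
    ⨍⁻ w in box δ ε, increment u K 3 w ∂volume
      ≤ 4 * (b + ENNReal.ofReal ε * spatialEnergy u K ε) := by
  have split (w : ℝ × ℝ) (hw : w ∈ box δ ε) :
      increment u K 3 w ≤ 4 * (b + increment u K 3 (0, w.2)) := by
    have := increment_add_le hu K (n := 3) (by norm_num) (w.1, 0) (0, w.2)
    norm_num at this
    exact this.trans (by gcongr; exact hb _ hw.1)
  have hN : Measurable fun y : ℝ => increment u K 3 (0, y) :=
    (measurable_increment hu K 3).comp (by fun_prop)
  calc ⨍⁻ w in box δ ε, increment u K 3 w ∂volume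
      ≤ ⨍⁻ w in box δ ε, 4 * (b + increment u K 3 (0, w.2)) ∂volume := by
        rw [setLAverage_eq, setLAverage_eq]
        gcongr 1
        exact setLIntegral_mono' (measurableSet_box δ ε) split
    _ = ⨍⁻ y in Icc (-ε) ε, 4 * (b + increment u K 3 (0, y)) ∂volume :=
        setLAverage_prod_snd (by simpa using hδ) (by simp) _ ((hN.const_add b).const_mul 4)
    _ ≤ 4 * (b + ⨍⁻ y in Icc (-ε) ε, increment u K 3 (0, y) ∂volume) := by
        rw [laverage, laverage, lintegral_const_mul _ (hN.const_add b),
          lintegral_add_left measurable_const, lintegral_const]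
        gcongr
        exact mul_le_of_le_one_right' prob_le_one
    _ ≤ 4 * (b + ENNReal.ofReal ε * spatialEnergy u K ε) := by
        gcongr
        exact setLAverage_Icc_le_mul_lintegral_div_sq _ hε

theorem exists_box_setLAverage_increment_le {u : ℝ × ℝ → ℝ} (hu : Measurable u)
    (h1 : MemLp u 1) (h2 : MemLp u 2) (h3 : MemLp u 3) {K : Set (ℝ × ℝ)} {r : ℝ} (hr : 0 < r)
    (henergy : spatialEnergy u K r ≠ ⊤) {κ : ℝ≥0∞} (hκ : 0 < κ) :
    ∃ δ ε : ℝ, 0 < δ ∧ 0 < ε ∧ δ ≤ r ∧ ε ≤ r ∧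
      ⨍⁻ w in box δ ε, increment u K 1 w ∂volume ≤ κ ∧
      ⨍⁻ w in box δ ε, increment u K 2 w ∂volume ≤ κ ∧
      ⨍⁻ w in box δ ε, increment u K 3 w ∂volume ≤ ENNReal.ofReal ε * κ := by
  have hκ' : 0 < κ / 8 := ENNReal.div_pos hκ.ne' (by simp)
  obtain ⟨ρ, hρ, increment_le⟩ := Metric.nhds_basis_closedBall.eventually_iff.1
    (((tendsto_increment (n := 1) le_rfl (by simpa using h1) K).eventually_le_const hκ).and
      ((tendsto_increment (n := 2) (by norm_num) h2 K).eventually_le_const hκ))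
  obtain ⟨ε, energy_le, hε, hεr⟩ := (((tendsto_setLIntegral_Icc_neg_self hr
    henergy).eventually_le_const hκ').and (Ioc_mem_nhdsGT (lt_min hr hρ))).exists
  obtain ⟨ρ', hρ', time_increment_le⟩ := Metric.nhds_basis_closedBall.eventually_iff.1
    ((tendsto_increment (n := 3) (by norm_num) h3 univ).eventually_le_const
      (ENNReal.mul_pos (ENNReal.ofReal_pos.2 hε).ne' hκ'.ne'))
  have hδ : 0 < min ρ' ε := lt_min hρ' hε
  have box_subset := box_subset_closedBall
    ((min_le_right ρ' ε).trans (hεr.trans (min_le_right r ρ))) (hεr.trans (min_le_right r ρ))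
  refine ⟨min ρ' ε, ε, hδ, hε, (min_le_right _ _).trans (hεr.trans (min_le_left _ _)),
    hεr.trans (min_le_left _ _),
    setLAverage_le_of_forall_mem_le (measurableSet_box _ _) fun w hw =>
      (increment_le (box_subset hw)).1,
    setLAverage_le_of_forall_mem_le (measurableSet_box _ _) fun w hw =>
      (increment_le (box_subset hw)).2, ?_⟩
  calc ⨍⁻ w in box (min ρ' ε) ε, increment u K 3 w ∂volume
      ≤ 4 * (ENNReal.ofReal ε * (κ / 8) + ENNReal.ofReal ε * spatialEnergy u K ε) := by
        refine setLAverage_box_increment_le hu K hδ hε fun τ hτ => time_increment_le ?_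
        exact box_subset_closedBall (min_le_left _ _) hρ'.le ⟨hτ, by simp⟩
    _ ≤ 4 * (ENNReal.ofReal ε * (κ / 8) + ENNReal.ofReal ε * (κ / 8)) := by
        gcongr
        exact energy_le
    _ = ENNReal.ofReal ε * (8 * (κ / 8)) := by ring
    _ = ENNReal.ofReal ε * κ := by
        rw [ENNReal.mul_div_cancel (by norm_num) (by norm_num)]

end ScaleSelection

section SmoothEntropies

open Filter Topology
open scoped Convolution ContDiff

theorem exists_mollifier_lintegral_error_le {u : ℝ × ℝ → ℝ} (hu : Measurable u)
    (h1 : MemLp u 1) (h2 : MemLp u 2) (h3 : MemLp u 3) {K : Set (ℝ × ℝ)} {r : ℝ} (hr : 0 < r)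
    (henergy : spatialEnergy u K r ≠ ⊤) {κ : ℝ≥0∞} (hκ : 0 < κ) :
    ∃ k : ℝ × ℝ → ℝ, ContDiff ℝ ∞ k ∧ HasCompactSupport k ∧ tsupport k ⊆ Metric.closedBall 0 r ∧
      ∫⁻ z in K, (‖(u ⋆ k) z - u z‖ₑ + (‖kernelVariance u k z‖ₑ
        + ‖kernelVariance u k z‖ₑ * ‖fderiv ℝ (u ⋆ k) z (0, 1)‖ₑ)) ≤ κ := by
  have hu1 : LocallyIntegrable u := (memLp_one_iff_integrable.1 h1).locallyIntegrable
  have hu2 : LocallyIntegrable (u ^ 2) := h2.integrable_sq.locallyIntegrable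
  obtain ⟨C, hC, exists_kernel⟩ := exists_isMollifier_box
  set c := ENNReal.ofReal C
  have hc : 2 * c + 2 * c ^ 2 ≠ 0 := by simpa [c] using hC
  have hc' : 2 * c + 2 * c ^ 2 ≠ ⊤ := by finiteness
  obtain ⟨δ, ε, hδ, hε, hδr, hεr, average₁, average₂, average₃⟩ :=
    exists_box_setLAverage_increment_le hu h1 h2 h3 hr henergy (ENNReal.div_pos hκ.ne' hc')
  obtain ⟨k, hk, hk'⟩ := exists_kernel δ hδ ε hε
  refine ⟨k, hk.contDiff, hk.hasCompactSupport,
    hk.tsupport_subset.trans (box_subset_closedBall hδr hεr), ?_⟩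
  have continuous_convolution {f : ℝ × ℝ → ℝ} (hf : LocallyIntegrable f) : Continuous (f ⋆ k) :=
    hk.hasCompactSupport.continuous_convolution_right _ hf hk.contDiff.continuous
  have measurable_error : Measurable fun z => ‖(u ⋆ k) z - u z‖ₑ :=
    ((continuous_convolution hu1).measurable.sub hu).enorm
  have measurable_kernelVariance : Measurable fun z => ‖kernelVariance u k z‖ₑ :=
    ((continuous_convolution hu2).sub ((continuous_convolution hu1).pow 2)).measurable.enorm
  rw [lintegral_add_left measurable_error, lintegral_add_left measurable_kernelVariance]
  calc (∫⁻ z in K, ‖(u ⋆ k) z - u z‖ₑ) + ((∫⁻ z in K, ‖kernelVariance u k z‖ₑ)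
        + ∫⁻ z in K, ‖kernelVariance u k z‖ₑ * ‖fderiv ℝ (u ⋆ k) z (0, 1)‖ₑ)
      ≤ c * (κ / (2 * c + 2 * c ^ 2)) + (c * (κ / (2 * c + 2 * c ^ 2)) + 2 * c *
          ENNReal.ofReal (C / ε) * (ENNReal.ofReal ε * (κ / (2 * c + 2 * c ^ 2)))) := by
        gcongr
        · exact (hk.lintegral_enorm_convolution_sub_le hu hu1 K).trans (by gcongr)
        · exact (hk.lintegral_enorm_kernelVariance_le hu hu1 hu2 K).trans (by gcongr)
        · exact (hk.lintegral_enorm_kernelVariance_mul_fderiv_le hu hu1 hu2 hk' K).trans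
            (by gcongr)
    _ = (2 * c + 2 * c * (ENNReal.ofReal (C / ε) * ENNReal.ofReal ε))
          * (κ / (2 * c + 2 * c ^ 2)) := by ring
    _ = κ := by
        rw [← ENNReal.ofReal_mul (by positivity), div_mul_cancel₀ C hε.ne', mul_assoc, ← sq,
          ENNReal.mul_div_cancel hc hc']

theorem fderiv_entropy_add_fderiv_flux {E : Type*} [NormedAddCommGroup E] [NormedSpace ℝ E]
    {V D φ : E → ℝ} {η q h : ℝ → ℝ} {z : E} (hV : DifferentiableAt ℝ V z)
    (hD : DifferentiableAt ℝ D z) (hφ : DifferentiableAt ℝ φ z)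
    (hh : DifferentiableAt ℝ h (V z)) (hη : HasDerivAt η (h (V z)) (V z))
    (hq : HasDerivAt q (V z * h (V z)) (V z)) (e₁ e₂ : E) :
    fderiv ℝ (fun z => η (V z) * φ z) z e₁
        + fderiv ℝ (fun z => (q (V z) + h (V z) * D z) * φ z) z e₂
      = η (V z) * fderiv ℝ φ z e₁ + q (V z) * fderiv ℝ φ z e₂
        + D z * (deriv h (V z) * fderiv ℝ V z e₂ * φ z + h (V z) * fderiv ℝ φ z e₂)
        + h (V z) * φ z * (fderiv ℝ V z e₁ + V z * fderiv ℝ V z e₂ + fderiv ℝ D z e₂) := by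
  have dη := hη.comp_hasFDerivAt z hV.hasFDerivAt
  have dq := hq.comp_hasFDerivAt z hV.hasFDerivAt
  have dh := hh.hasDerivAt.comp_hasFDerivAt z hV.hasFDerivAt
  have dA : HasFDerivAt (fun z => η (V z) * φ z) _ z := dη.mul hφ.hasFDerivAt
  have dB : HasFDerivAt (fun z => (q (V z) + h (V z) * D z) * φ z) _ z :=
    (dq.add (dh.mul hD.hasFDerivAt)).mul hφ.hasFDerivAt
  rw [dA.fderiv, dB.fderiv]
  simp only [add_apply, smul_apply, Pi.add_apply, Pi.mul_apply, Function.comp_apply, smul_eq_mul]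
  ring

theorem integral_entropy_identity {E : Type*} [NormedAddCommGroup E] [NormedSpace ℝ E]
    [FiniteDimensional ℝ E] [MeasureSpace E] [BorelSpace E] [(volume : Measure E).IsAddHaarMeasure]
    {V D φ : E → ℝ} {η q h : ℝ → ℝ} (hV : ContDiff ℝ 1 V) (hD : ContDiff ℝ 1 D)
    (hφ : ContDiff ℝ 1 φ) (hφc : HasCompactSupport φ) (hh : ContDiff ℝ 1 h)
    (hη : ∀ x, HasDerivAt η (h x) x) (hq : ∀ x, HasDerivAt q (x * h x) x) {e₁ e₂ : E}
    (heq : ∀ z ∈ tsupport φ,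
      fderiv ℝ V z e₁ + V z * fderiv ℝ V z e₂ + fderiv ℝ D z e₂ = 0) :
    Integrable (fun z => η (V z) * fderiv ℝ φ z e₁ + q (V z) * fderiv ℝ φ z e₂
        + D z * (deriv h (V z) * fderiv ℝ V z e₂ * φ z + h (V z) * fderiv ℝ φ z e₂)) ∧
      ∫ z, (η (V z) * fderiv ℝ φ z e₁ + q (V z) * fderiv ℝ φ z e₂
        + D z * (deriv h (V z) * fderiv ℝ V z e₂ * φ z + h (V z) * fderiv ℝ φ z e₂)) = 0 := by
  have contDiff_of_hasDerivAt {f g : ℝ → ℝ} (hf : ∀ x, HasDerivAt f (g x) x)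
      (hg : Continuous g) : ContDiff ℝ 1 f :=
    contDiff_one_iff_deriv.2 ⟨fun x => (hf x).differentiableAt,
      by rwa [funext fun x => (hf x).deriv]⟩
  have hA : ContDiff ℝ 1 fun z => η (V z) * φ z :=
    ((contDiff_of_hasDerivAt hη hh.continuous).comp hV).mul hφ
  have hB : ContDiff ℝ 1 fun z => (q (V z) + h (V z) * D z) * φ z :=
    (((contDiff_of_hasDerivAt hq (continuous_id.mul hh.continuous)).comp hV).add
      ((hh.comp hV).mul hD)).mul hφ
  have eq_divergence : (fun z => η (V z) * fderiv ℝ φ z e₁ + q (V z) * fderiv ℝ φ z e₂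
        + D z * (deriv h (V z) * fderiv ℝ V z e₂ * φ z + h (V z) * fderiv ℝ φ z e₂))
      = fun z => fderiv ℝ (fun z => η (V z) * φ z) z e₁
        + fderiv ℝ (fun z => (q (V z) + h (V z) * D z) * φ z) z e₂ := by
    ext z
    rw [fderiv_entropy_add_fderiv_flux (hV.differentiable one_ne_zero z)
      (hD.differentiable one_ne_zero z) (hφ.differentiable one_ne_zero z)
      (hh.differentiable one_ne_zero _) (hη _) (hq _)]
    by_cases hz : z ∈ tsupport φ
    · rw [heq z hz, mul_zero, add_zero]
    · rw [image_eq_zero_of_notMem_tsupport hz, mul_zero, mul_zero, zero_mul, add_zero]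
  have iA := integrable_fderiv_apply hA hφc.mul_left e₁
  have iB := integrable_fderiv_apply hB hφc.mul_left e₂
  rw [eq_divergence]
  refine ⟨iA.add iB, ?_⟩
  rw [integral_add iA iB, integral_fderiv_apply_eq_zero hA hφc.mul_left,
    integral_fderiv_apply_eq_zero hB hφc.mul_left, add_zero]

theorem abs_entropy_error_le {P u V η₁ η₂ q₁ q₂ φt φs φ D Vs h h' : ℝ}
    (hη : |η₁ - η₂| ≤ P * |V - u|) (hq : |q₁ - q₂| ≤ P * |V - u|) (hφt : |φt| ≤ P)
    (hφs : |φs| ≤ P) (hφ : |φ| ≤ P) (hh : |h| ≤ P) (hh' : |h'| ≤ P) :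
    |η₁ * φt + q₁ * φs - (η₂ * φt + q₂ * φs + D * (h' * Vs * φ + h * φs))|
      ≤ 2 * P ^ 2 * (|V - u| + (|D| + |D| * |Vs|)) := by
  have hP : 0 ≤ P := (abs_nonneg φ).trans hφ
  calc |η₁ * φt + q₁ * φs - (η₂ * φt + q₂ * φs + D * (h' * Vs * φ + h * φs))|
      = |(η₁ - η₂) * φt + (q₁ - q₂) * φs - (D * (h' * Vs * φ) + D * (h * φs))| := by ring_nf
    _ ≤ |η₁ - η₂| * |φt| + |q₁ - q₂| * |φs| + (|D| * (|h'| * |Vs| * |φ|) + |D| * (|h| * |φs|)) := by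
        simp only [← abs_mul]
        exact (abs_sub _ _).trans (add_le_add (abs_add_le _ _) (abs_add_le _ _))
    _ ≤ P * |V - u| * P + P * |V - u| * P + (|D| * (P * |Vs| * P) + |D| * (P * P)) := by gcongr
    _ = 2 * P ^ 2 * |V - u| + P ^ 2 * (|D| + |D| * |Vs|) := by ring
    _ ≤ 2 * P ^ 2 * |V - u| + 2 * P ^ 2 * (|D| + |D| * |Vs|) := by
        gcongr
        exact le_mul_of_one_le_left (sq_nonneg P) one_le_two
    _ = 2 * P ^ 2 * (|V - u| + (|D| + |D| * |Vs|)) := by ring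

theorem enorm_entropy_error_le {P u V η₁ η₂ q₁ q₂ φt φs φ D Vs h h' : ℝ}
    (hη : |η₁ - η₂| ≤ P * |V - u|) (hq : |q₁ - q₂| ≤ P * |V - u|) (hφt : |φt| ≤ P)
    (hφs : |φs| ≤ P) (hφ : |φ| ≤ P) (hh : |h| ≤ P) (hh' : |h'| ≤ P) :
    ‖η₁ * φt + q₁ * φs - (η₂ * φt + q₂ * φs + D * (h' * Vs * φ + h * φs))‖ₑ
      ≤ ENNReal.ofReal (2 * P ^ 2) * (‖V - u‖ₑ + (‖D‖ₑ + ‖D‖ₑ * ‖Vs‖ₑ)) := by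
  simp only [Real.enorm_eq_ofReal_abs]
  rw [← ENNReal.ofReal_mul (abs_nonneg _), ← ENNReal.ofReal_add (by positivity) (by positivity),
    ← ENNReal.ofReal_add (by positivity) (by positivity), ← ENNReal.ofReal_mul (by positivity)]
  exact ENNReal.ofReal_le_ofReal (abs_entropy_error_le hη hq hφt hφs hφ hh hh')

theorem eventually_atTop_forall_abs_le {X : Type*} [TopologicalSpace X] {f : X → ℝ}
    (hf : Continuous f) (hfc : HasCompactSupport f) : ∀ᶠ P in atTop, ∀ x, |f x| ≤ P := by
  obtain ⟨C, hC⟩ := hf.bounded_above_of_compact_support hfc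
  filter_upwards [eventually_ge_atTop C] with P hP x using (hC x).trans hP

theorem fderiv_eq_zero_of_notMem_tsupport {E : Type*} [NormedAddCommGroup E] [NormedSpace ℝ E]
    {φ : E → ℝ} {z : E} (hz : z ∉ tsupport φ) : fderiv ℝ φ z = 0 :=
  image_eq_zero_of_notMem_tsupport fun h => hz (tsupport_fderiv_subset ℝ h)

theorem exists_enorm_integral_entropy_le {E : Type*} [NormedAddCommGroup E] [NormedSpace ℝ E]
    [FiniteDimensional ℝ E] [MeasureSpace E] [BorelSpace E] [(volume : Measure E).IsAddHaarMeasure]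
    {φ : E → ℝ} {η q h : ℝ → ℝ} (hφ : ContDiff ℝ 1 φ) (hφc : HasCompactSupport φ)
    (hh : ContDiff ℝ 1 h) (hhc : HasCompactSupport h) (hη : ∀ x, HasDerivAt η (h x) x)
    (hq : ∀ x, HasDerivAt q (x * h x) x) (e₁ e₂ : E) :
    ∃ P : ℝ≥0∞, P ≠ ⊤ ∧ ∀ u V D : E → ℝ, ContDiff ℝ 1 V → ContDiff ℝ 1 D →
      (∀ z ∈ tsupport φ, fderiv ℝ V z e₁ + V z * fderiv ℝ V z e₂ + fderiv ℝ D z e₂ = 0) →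
      ‖∫ z, (η (u z) * fderiv ℝ φ z e₁ + q (u z) * fderiv ℝ φ z e₂)‖ₑ
        ≤ P * ∫⁻ z in tsupport φ, (‖V z - u z‖ₑ + (‖D z‖ₑ + ‖D z‖ₑ * ‖fderiv ℝ V z e₂‖ₑ)) := by
  have continuous_fderiv_apply (e : E) : Continuous fun z => fderiv ℝ φ z e :=
    (hφ.continuous_fderiv one_ne_zero).clm_apply continuous_const
  obtain ⟨P, ⟨⟨bound_h, bound_h'⟩, bound_id_mul_h⟩, ⟨bound_φ, bound_e₁⟩, bound_e₂⟩ :=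
    ((((eventually_atTop_forall_abs_le hh.continuous hhc).and
      (eventually_atTop_forall_abs_le (hh.continuous_deriv le_rfl) hhc.deriv)).and
      (eventually_atTop_forall_abs_le (continuous_id.mul hh.continuous) hhc.mul_left)).and
      (((eventually_atTop_forall_abs_le hφ.continuous hφc).and
      (eventually_atTop_forall_abs_le (continuous_fderiv_apply e₁)
        (hφc.fderiv_apply (𝕜 := ℝ) e₁))).and
      (eventually_atTop_forall_abs_le (continuous_fderiv_apply e₂)
        (hφc.fderiv_apply (𝕜 := ℝ) e₂)))).exists
  have lipschitz {f g : ℝ → ℝ} (hf : ∀ x, HasDerivAt f (g x) x) (hg : ∀ x, |g x| ≤ P) (x y : ℝ) :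
      |f x - f y| ≤ P * |y - x| := by
    rw [abs_sub_comm y]
    exact convex_univ.norm_image_sub_le_of_norm_hasDerivWithin_le
      (fun x _ => (hf x).hasDerivWithinAt) (fun x _ => hg x) (mem_univ y) (mem_univ x)
  refine ⟨ENNReal.ofReal (2 * P ^ 2), ENNReal.ofReal_ne_top, fun u V D hV hD heq => ?_⟩
  by_cases hint : Integrable fun z => η (u z) * fderiv ℝ φ z e₁ + q (u z) * fderiv ℝ φ z e₂
  swap
  · simp [integral_undef hint]
  obtain ⟨hint', integral_eq_zero⟩ := integral_entropy_identity hV hD hφ hφc hh hη hq heq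
  rw [← sub_zero (∫ z, _), ← integral_eq_zero, ← integral_sub hint hint',
    ← lintegral_const_mul' _ _ ENNReal.ofReal_ne_top,
    ← lintegral_indicator (isClosed_tsupport φ).measurableSet]
  refine (enorm_integral_le_lintegral_enorm _).trans (lintegral_mono fun z => ?_)
  by_cases hz : z ∈ tsupport φ
  · rw [indicator_of_mem hz]
    exact enorm_entropy_error_le (lipschitz hη bound_h _ _) (lipschitz hq bound_id_mul_h _ _)
      (bound_e₁ z) (bound_e₂ z) (bound_φ z) (bound_h _) (bound_h' _)
  · simp [fderiv_eq_zero_of_notMem_tsupport hz, image_eq_zero_of_notMem_tsupport hz]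

theorem weakPairing_eq_integral {Ω : Opens (ℝ × ℝ)} {a b a' b' : ℝ × ℝ → ℝ} (φ : 𝓓(Ω, ℝ))
    (ha : ∀ z ∈ tsupport φ, a z = a' z) (hb : ∀ z ∈ tsupport φ, b z = b' z) :
    weakPairing Ω a b φ = ∫ z, (a' z * fderiv ℝ φ z (1, 0) + b' z * fderiv ℝ φ z (0, 1)) := by
  rw [weakPairing, setIntegral_eq_integral_of_forall_compl_eq_zero]
  · congr 1
    ext z
    by_cases hz : z ∈ tsupport φ
    · rw [ha z hz, hb z hz]
    · simp [fderiv_eq_zero_of_notMem_tsupport hz]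
  · intro z hz
    simp [fderiv_eq_zero_of_notMem_tsupport (φ := φ) fun h => hz (φ.tsupport_subset h)]

theorem WeakBalance.fderiv_convolution_add_eq_zero {Ω : Opens (ℝ × ℝ)} {a b a' b' k : ℝ × ℝ → ℝ}
    (hab : WeakBalance Ω a b) (hk : ContDiff ℝ ∞ k) (hkc : HasCompactSupport k)
    (ha' : LocallyIntegrable a') (hb' : LocallyIntegrable b') {z : ℝ × ℝ}
    (hz : ∀ w ∈ tsupport k, z - w ∈ Ω ∧ a (z - w) = a' (z - w) ∧ b (z - w) = b' (z - w)) :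
    fderiv ℝ (a' ⋆ k) z (1, 0) + fderiv ℝ (b' ⋆ k) z (0, 1) = 0 := by
  have tsupport_subset : tsupport (fun w => k (z - w)) ⊆ {w | z - w ∈ tsupport k} :=
    closure_minimal (fun w hw => subset_tsupport k hw)
      ((isClosed_tsupport k).preimage (by fun_prop))
  have agree {w : ℝ × ℝ} (hw : w ∈ tsupport fun w => k (z - w)) :
      w ∈ Ω ∧ a w = a' w ∧ b w = b' w := by
    simpa only [sub_sub_cancel] using hz _ (tsupport_subset hw)
  let ψ : 𝓓(Ω, ℝ) :=
    { toFun := fun w => k (z - w)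
      contDiff' := hk.comp (by fun_prop)
      hasCompactSupport' := hkc.comp_homeomorph (Homeomorph.subLeft z)
      tsupport_subset' := fun w hw => (agree hw).1 }
  have fderiv_ψ (w e : ℝ × ℝ) : fderiv ℝ ψ w e = -fderiv ℝ k (z - w) e := by
    have hasFDerivAt_k := (hk.differentiable (by simp)).differentiableAt (x := z - w) |>.hasFDerivAt
    have hasFDerivAt_ψ : HasFDerivAt ψ _ w :=
      hasFDerivAt_k.comp w ((hasFDerivAt_id w).const_sub z)
    rw [hasFDerivAt_ψ.fderiv]
    simp
  have pairing_eq := hab.eq_zero ψ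
  rw [weakPairing_eq_integral ψ (fun w hw => (agree hw).2.1) (fun w hw => (agree hw).2.2)]
    at pairing_eq
  have integrable_mul {f : ℝ × ℝ → ℝ} (hf : LocallyIntegrable f) (e : ℝ × ℝ) :
      Integrable fun w => f w * fderiv ℝ k (z - w) e :=
    (hkc.fderiv_apply (𝕜 := ℝ) e).convolutionExists_right (μ := volume)
      (ContinuousLinearMap.lsmul ℝ ℝ) hf
      ((hk.continuous_fderiv (by simp)).clm_apply continuous_const) z
  simp only [fderiv_ψ, mul_neg, ← neg_add, integral_neg, neg_eq_zero] at pairing_eq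
  rw [integral_add (integrable_mul ha' _) (integrable_mul hb' _)] at pairing_eq
  have hk1 : ContDiff ℝ 1 k := hk.of_le (by simp)
  rw [fderiv_convolution_apply ha' hk1 hkc, fderiv_convolution_apply hb' hk1 hkc]
  exact pairing_eq

theorem IsBurgersSolution.fderiv_convolution_add_eq_zero {Ω : Opens (ℝ × ℝ)} {v u k : ℝ × ℝ → ℝ}
    (hv : IsBurgersSolution Ω v) (hk : ContDiff ℝ ∞ k) (hkc : HasCompactSupport k)
    (hu : LocallyIntegrable u) (hu2 : LocallyIntegrable (u ^ 2)) {z : ℝ × ℝ}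
    (hz : ∀ w ∈ tsupport k, z - w ∈ Ω ∧ u (z - w) = v (z - w)) :
    fderiv ℝ (u ⋆ k) z (1, 0) + (u ⋆ k) z * fderiv ℝ (u ⋆ k) z (0, 1)
      + fderiv ℝ (fun z => kernelVariance u k z / 2) z (0, 1) = 0 := by
  have differentiable_convolution {f : ℝ × ℝ → ℝ} (hf : LocallyIntegrable f) :
      DifferentiableAt ℝ (f ⋆ k) z :=
    (hkc.contDiff_convolution_right (n := 1) _ hf (hk.of_le (by simp))).differentiable
      one_ne_zero z
  have mollified : fderiv ℝ (u ⋆ k) z (1, 0) + fderiv ℝ (((2 : ℝ)⁻¹ • u ^ 2) ⋆ k) z (0, 1) = 0 :=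
    WeakBalance.fderiv_convolution_add_eq_zero hv hk hkc hu (hu2.smul _) fun w hw => by
      refine ⟨(hz w hw).1, (hz w hw).2.symm, ?_⟩
      simp only [Pi.smul_apply, Pi.pow_apply, smul_eq_mul, (hz w hw).2]
      ring
  have hV := (differentiable_convolution hu).hasFDerivAt
  have hS := (differentiable_convolution hu2).hasFDerivAt
  have hD : HasFDerivAt (fun z => kernelVariance u k z / 2) _ z :=
    (hS.sub (hV.pow 2)).mul_const (2 : ℝ)⁻¹
  rw [smul_convolution, (hS.const_smul (2 : ℝ)⁻¹).fderiv] at mollified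
  rw [hD.fderiv]
  simp only [smul_apply, sub_apply, smul_eq_mul, nsmul_eq_mul, Nat.add_one_sub_one, pow_one,
    Nat.cast_ofNat] at mollified ⊢
  linarith

/-- `v ∈ L^p_loc(Ω)`. -/
def MemLpLoc (p : ℝ≥0∞) (Ω : Opens (ℝ × ℝ)) (v : ℝ × ℝ → ℝ) : Prop :=
  ∀ K : Set (ℝ × ℝ), IsCompact K → K ⊆ Ω → MemLp v p (volume.restrict K)

/-- Local form of the regularity `v ∈ L³_t W^{1/3,3}_s`, phrased with increments so that it makes
sense on an arbitrary open set. -/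
def HasLocallyFiniteEnergy (Ω : Opens (ℝ × ℝ)) (v : ℝ × ℝ → ℝ) : Prop :=
  ∀ K : Set (ℝ × ℝ), IsCompact K → K ⊆ Ω → ∃ r > 0, spatialEnergy v K r ≠ ⊤

theorem exists_memLp_eqOn_add_closedBall {Ω : Opens (ℝ × ℝ)} {v : ℝ × ℝ → ℝ} (hvm : Measurable v)
    (hv : MemLpLoc 3 Ω v) (henergy : HasLocallyFiniteEnergy Ω v) {K : Set (ℝ × ℝ)}
    (hK : IsCompact K) (hKΩ : K ⊆ Ω) :
    ∃ (u : ℝ × ℝ → ℝ) (r : ℝ), 0 < r ∧ Measurable u ∧ (∀ p ≤ 3, MemLp u p) ∧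
      spatialEnergy u K r ≠ ⊤ ∧
      ∀ z ∈ K, ∀ w ∈ Metric.closedBall 0 r, z - w ∈ Ω ∧ u (z - w) = v (z - w) := by
  obtain ⟨ρ, hρ, thickening_subset⟩ := hK.exists_cthickening_subset_open Ω.isOpen hKΩ
  obtain ⟨r, hr, energy_ne_top⟩ := henergy K hK hKΩ
  have sub_mem {z w : ℝ × ℝ} (hz : z ∈ K) (hw : ‖w‖ ≤ min ρ r) : z - w ∈ Metric.cthickening ρ K :=
    Metric.mem_cthickening_of_dist_le _ z _ _ hz
      (by simpa [dist_eq_norm] using hw.trans (min_le_left ρ r))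
  have isFiniteMeasure : IsFiniteMeasure (volume.restrict (Metric.cthickening ρ K)) :=
    isFiniteMeasure_restrict.2 hK.cthickening.measure_lt_top.ne
  refine ⟨(Metric.cthickening ρ K).indicator v, min ρ r, lt_min hρ hr,
    hvm.indicator hK.cthickening.measurableSet, fun p hp => ?_, ?_, fun z hz w hw => ?_⟩
  · rw [memLp_indicator_iff_restrict hK.cthickening.measurableSet]
    exact (hv _ hK.cthickening thickening_subset).mono_exponent hp
  · refine ne_top_of_le_ne_top energy_ne_top <| calc
      spatialEnergy ((Metric.cthickening ρ K).indicator v) K (min ρ r)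
          = ∫⁻ y in Icc (-min ρ r) (min ρ r), increment v K 3 (0, y) / ‖y‖ₑ ^ 2 := by
            refine setLIntegral_congr_fun measurableSet_Icc fun y hy => ?_
            dsimp only [increment]
            congr 1
            refine setLIntegral_congr_fun hK.measurableSet fun z hz => ?_
            have norm_le : ‖((0 : ℝ), y)‖ ≤ min ρ r := by
              simpa [Prod.norm_mk, (lt_min hρ hr).le] using abs_le.2 hy
            rw [indicator_of_mem (sub_mem hz norm_le),
              indicator_of_mem (Metric.self_subset_cthickening K hz)]
      _ ≤ spatialEnergy v K r :=
            lintegral_mono_set (Icc_subset_Icc (neg_le_neg (min_le_right ρ r)) (min_le_right ρ r))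
  · have mem := sub_mem hz (mem_closedBall_zero_iff.1 hw)
    exact ⟨thickening_subset mem, indicator_of_mem mem v⟩

theorem IsBurgersSolution.weakPairing_eq_zero {Ω : Opens (ℝ × ℝ)} {v : ℝ × ℝ → ℝ}
    (hsol : IsBurgersSolution Ω v) (hvm : Measurable v) (hv : MemLpLoc 3 Ω v)
    (henergy : HasLocallyFiniteEnergy Ω v) {η q h : ℝ → ℝ} (hh : ContDiff ℝ 1 h)
    (hhc : HasCompactSupport h) (hη : ∀ x, HasDerivAt η (h x) x)
    (hq : ∀ x, HasDerivAt q (x * h x) x) (φ : 𝓓(Ω, ℝ)) :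
    weakPairing Ω (fun z => η (v z)) (fun z => q (v z)) φ = 0 := by
  obtain ⟨u, r, hr, hum, hu, energy_ne_top, agree⟩ :=
    exists_memLp_eqOn_add_closedBall hvm hv henergy φ.hasCompactSupport φ.tsupport_subset
  have h1 : MemLp u 1 := hu 1 (by norm_num)
  have h2 : MemLp u 2 := hu 2 (by norm_num)
  have hu1 : LocallyIntegrable u := (memLp_one_iff_integrable.1 h1).locallyIntegrable
  have hu2 : LocallyIntegrable (u ^ 2) := h2.integrable_sq.locallyIntegrable
  have eq_on_tsupport : ∀ z ∈ tsupport φ, v z = u z := fun z hz => by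
    simpa using (agree z hz 0 (Metric.mem_closedBall_self hr.le)).2.symm
  rw [weakPairing_eq_integral φ (fun z hz => by rw [eq_on_tsupport z hz])
    (fun z hz => by rw [eq_on_tsupport z hz]), ← enorm_eq_zero]
  obtain ⟨P, hP, stability⟩ := exists_enorm_integral_entropy_le (φ.contDiff.of_le (by simp))
    φ.hasCompactSupport hh hhc hη hq (1, 0) (0, 1)
  have le_mul (κ : ℝ≥0∞) (hκ : 0 < κ) :
      ‖∫ z, (η (u z) * fderiv ℝ φ z (1, 0) + q (u z) * fderiv ℝ φ z (0, 1))‖ₑ ≤ P * κ := by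
    obtain ⟨k, hk, hkc, tsupport_subset, error_le⟩ :=
      exists_mollifier_lintegral_error_le hum h1 h2 (hu 3 le_rfl) hr energy_ne_top hκ
    have contDiff_convolution {f : ℝ × ℝ → ℝ} (hf : LocallyIntegrable f) :
        ContDiff ℝ 1 (f ⋆ k) := hkc.contDiff_convolution_right _ hf (hk.of_le (by simp))
    refine (stability u (u ⋆ k) (fun z => kernelVariance u k z / 2) (contDiff_convolution hu1)
      (((contDiff_convolution hu2).sub ((contDiff_convolution hu1).pow 2)).div_const 2)
      fun z hz => hsol.fderiv_convolution_add_eq_zero hk hkc hu1 hu2 fun w hw =>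
        agree z hz w (tsupport_subset hw)).trans ?_
    have half_le (z : ℝ × ℝ) : ‖kernelVariance u k z / 2‖ₑ ≤ ‖kernelVariance u k z‖ₑ := by
      rw [Real.enorm_eq_ofReal_abs, Real.enorm_eq_ofReal_abs, abs_div, abs_two]
      exact ENNReal.ofReal_le_ofReal (half_le_self (abs_nonneg _))
    exact mul_le_mul_right
      ((lintegral_mono fun z => by gcongr <;> exact half_le z).trans error_le) P
  have tendsto_zero : Tendsto (fun n : ℕ => P * (n : ℝ≥0∞)⁻¹) atTop (𝓝 0) := by
    simpa using ENNReal.Tendsto.const_mul ENNReal.tendsto_inv_nat_nhds_zero (.inr hP)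
  exact le_antisymm (ge_of_tendsto' tendsto_zero fun n => le_mul _ (by simp)) bot_le

end SmoothEntropies

section SuperlevelIntegral

open Filter Topology

variable {X : Type*} [MeasurableSpace X] {μ : Measure X} {v f : X → ℝ}

/-- The integral of `f` over the superlevel set `{v > ξ}`, as a function of the level `ξ`. -/
noncomputable def superlevelIntegral (μ : Measure X) (v f : X → ℝ) (ξ : ℝ) : ℝ :=
  ∫ x in {x | ξ < v x}, f x ∂μ

theorem superlevelIntegral_eq_integral_indicator (hv : Measurable v) (ξ : ℝ) :
    superlevelIntegral μ v f ξ = ∫ x, {x | ξ < v x}.indicator f x ∂μ :=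
  (integral_indicator (measurableSet_lt measurable_const hv)).symm

theorem tendsto_superlevelIntegral (hv : Measurable v) (hf : Integrable f μ) (ξ : ℝ) :
    Tendsto (superlevelIntegral μ v f) (𝓝[>] ξ) (𝓝 (superlevelIntegral μ v f ξ)) := by
  simp only [funext (superlevelIntegral_eq_integral_indicator (μ := μ) (f := f) hv)]
  refine tendsto_integral_filter_of_dominated_convergence (fun x => ‖f x‖)
    (.of_forall fun ξ' => (hf.indicator (measurableSet_lt measurable_const hv)).1)
    (.of_forall fun ξ' => .of_forall fun x => norm_indicator_le_norm_self _ _) hf.norm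
    (.of_forall fun x => tendsto_nhds_of_eventually_eq ?_)
  by_cases hx : ξ < v x
  · filter_upwards [Ioo_mem_nhdsGT hx] with ξ' hξ'
    rw [indicator_of_mem (by exact hξ'.2), indicator_of_mem (by exact hx)]
  · filter_upwards [self_mem_nhdsWithin] with ξ' hξ'
    rw [indicator_of_notMem (by exact fun h => hx (lt_trans hξ' h)),
      indicator_of_notMem (by exact hx)]

theorem norm_superlevelIntegral_le (hf : Integrable f μ) (ξ : ℝ) :
    ‖superlevelIntegral μ v f ξ‖ ≤ ∫ x, ‖f x‖ ∂μ :=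
  (norm_integral_le_integral_norm _).trans
    (setIntegral_le_integral hf.norm (.of_forall fun _ => norm_nonneg _))

theorem locallyIntegrable_superlevelIntegral [SFinite μ] (hv : Measurable v)
    (hf : Integrable f μ) : LocallyIntegrable (superlevelIntegral μ v f) := by
  have measurable_indicator : AEStronglyMeasurable
      ({p : ℝ × X | p.1 < v p.2}.indicator fun p => f p.2) (volume.prod μ) :=
    hf.1.comp_snd.indicator (measurableSet_lt measurable_fst (hv.comp measurable_snd))
  refine (locallyIntegrable_const (∫ x, ‖f x‖ ∂μ)).mono ?_
    (.of_forall fun ξ => (norm_superlevelIntegral_le hf ξ).trans (le_abs_self _))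
  rw [funext (superlevelIntegral_eq_integral_indicator (μ := μ) (f := f) hv)]
  exact measurable_indicator.integral_prod_right'

theorem integral_mul_superlevelIntegral [SFinite μ] (hv : Measurable v) (hf : Integrable f μ)
    {g : ℝ → ℝ} (hg : Integrable g) :
    Integrable (fun x => (∫ ξ in Iio (v x), g ξ) * f x) μ ∧
      Integrable (fun ξ => g ξ * superlevelIntegral μ v f ξ) ∧
      ∫ x, (∫ ξ in Iio (v x), g ξ) * f x ∂μ = ∫ ξ, g ξ * superlevelIntegral μ v f ξ := by
  let F : X × ℝ → ℝ := {p | p.2 < v p.1}.indicator fun p => f p.1 * g p.2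
  have integrable_F : Integrable F (μ.prod volume) :=
    (hf.mul_prod hg).indicator (measurableSet_lt measurable_snd (hv.comp measurable_fst))
  have integral_snd (x : X) : ∫ ξ, F (x, ξ) = (∫ ξ in Iio (v x), g ξ) * f x := by
    rw [← integral_indicator measurableSet_Iio, ← integral_mul_const]
    congr 1 with ξ
    simp [F, indicator, mul_comm]
  have integral_fst (ξ : ℝ) : ∫ x, F (x, ξ) ∂μ = g ξ * superlevelIntegral μ v f ξ := by
    rw [superlevelIntegral_eq_integral_indicator hv, ← integral_const_mul]
    congr 1 with x
    simp [F, indicator, mul_comm]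
  simp only [← integral_snd, ← integral_fst]
  exact ⟨integrable_F.integral_prod_left, integrable_F.integral_prod_right,
    integral_integral_swap integrable_F⟩

end SuperlevelIntegral

section KineticFormulation

open Filter Topology
open scoped ContDiff

/-- The transport operator `∂_t + ξ ∂_s` tested against the superlevel set `{v > ξ}`. -/
noncomputable def superlevelPairing (v φ : ℝ × ℝ → ℝ) (ξ : ℝ) : ℝ :=
  ∫ z in {z | ξ < v z}, fderiv ℝ φ z (1, ξ)

/-- The kinetic formulation of Burgers' equation without dissipation: for every `ξ`, the
indicator of `{v > ξ}` is transported with speed `ξ`. -/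
def IsKineticSolution (Ω : Opens (ℝ × ℝ)) (v : ℝ × ℝ → ℝ) : Prop :=
  ∀ (φ : 𝓓(Ω, ℝ)) (ξ : ℝ), superlevelPairing v φ ξ = 0

variable {Ω : Opens (ℝ × ℝ)} {v : ℝ × ℝ → ℝ}

theorem integrable_fderiv_testFunction (φ : 𝓓(Ω, ℝ)) (e : ℝ × ℝ) :
    Integrable fun z => fderiv ℝ φ z e :=
  integrable_fderiv_apply (φ.contDiff.of_le (by simp)) φ.hasCompactSupport e

theorem superlevelPairing_eq (φ : 𝓓(Ω, ℝ)) (ξ : ℝ) :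
    superlevelPairing v φ ξ = superlevelIntegral volume v (fun z => fderiv ℝ φ z (1, 0)) ξ
      + ξ * superlevelIntegral volume v (fun z => fderiv ℝ φ z (0, 1)) ξ := by
  have fderiv_eq (z : ℝ × ℝ) :
      fderiv ℝ φ z (1, ξ) = fderiv ℝ φ z (1, 0) + ξ * fderiv ℝ φ z (0, 1) := by
    rw [← smul_eq_mul, ← map_smul, ← map_add]
    simp
  simp only [superlevelPairing, superlevelIntegral, fderiv_eq]
  rw [integral_add (integrable_fderiv_testFunction φ _).integrableOn
      ((integrable_fderiv_testFunction φ _).integrableOn.const_mul ξ), integral_const_mul]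

theorem tendsto_superlevelPairing (hv : Measurable v) (φ : 𝓓(Ω, ℝ)) (ξ : ℝ) :
    Tendsto (superlevelPairing v φ) (𝓝[>] ξ) (𝓝 (superlevelPairing v φ ξ)) := by
  simp only [funext (superlevelPairing_eq (v := v) φ)]
  exact (tendsto_superlevelIntegral hv (integrable_fderiv_testFunction φ _) ξ).add
    ((tendsto_id.mono_left nhdsWithin_le_nhds).mul
      (tendsto_superlevelIntegral hv (integrable_fderiv_testFunction φ _) ξ))

theorem locallyIntegrable_superlevelPairing (hv : Measurable v) (φ : 𝓓(Ω, ℝ)) :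
    LocallyIntegrable (superlevelPairing v φ) := by
  rw [funext (superlevelPairing_eq (v := v) φ)]
  exact (locallyIntegrable_superlevelIntegral hv (integrable_fderiv_testFunction φ _)).add
    ((locallyIntegrable_superlevelIntegral hv (integrable_fderiv_testFunction φ _)).continuous_smul
      continuous_id)

theorem integral_mul_superlevelPairing (hv : Measurable v) (φ : 𝓓(Ω, ℝ)) {g : ℝ → ℝ}
    (hg : Integrable g) (hg' : Integrable fun ξ => ξ * g ξ) :
    ∫ z, ((∫ ξ in Iio (v z), g ξ) * fderiv ℝ φ z (1, 0)
        + (∫ ξ in Iio (v z), ξ * g ξ) * fderiv ℝ φ z (0, 1))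
      = ∫ ξ, g ξ * superlevelPairing v φ ξ := by
  obtain ⟨it, it', ht⟩ :=
    integral_mul_superlevelIntegral hv (integrable_fderiv_testFunction φ (1, 0)) hg
  obtain ⟨is, is', hs⟩ :=
    integral_mul_superlevelIntegral hv (integrable_fderiv_testFunction φ (0, 1)) hg'
  rw [integral_add it is, ht, hs, ← integral_add it' is']
  congr 1 with ξ
  rw [superlevelPairing_eq]
  ring

theorem hasDerivAt_integral_Iio {f : ℝ → ℝ} (hf : Continuous f) (hfi : Integrable f) (x : ℝ) :
    HasDerivAt (fun x => ∫ ξ in Iio x, f ξ) (f x) x := by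
  have eq_intervalIntegral : (fun x => ∫ ξ in Iio x, f ξ)
      = fun x => (∫ ξ in (0 : ℝ)..x, f ξ) + ∫ ξ in Iic 0, f ξ := by
    ext y
    rw [← intervalIntegral.integral_Iic_sub_Iic hfi.integrableOn hfi.integrableOn,
      integral_Iic_eq_integral_Iio, sub_add_cancel]
  rw [eq_intervalIntegral]
  exact (intervalIntegral.integral_hasDerivAt_right (hf.intervalIntegrable _ _)
    hf.aestronglyMeasurable.stronglyMeasurableAtFilter hf.continuousAt).add_const _

theorem IsBurgersSolution.isKineticSolution (hsol : IsBurgersSolution Ω v) (hvm : Measurable v)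
    (hv : MemLpLoc 3 Ω v) (henergy : HasLocallyFiniteEnergy Ω v) : IsKineticSolution Ω v := by
  intro φ ξ
  have ae_eq_zero : ∀ᵐ ξ : ℝ, superlevelPairing v φ ξ = 0 := by
    refine ae_eq_zero_of_integral_contDiff_smul_eq_zero
      (locallyIntegrable_superlevelPairing hvm φ) fun h hh hhc => ?_
    have continuous_mul : Continuous fun x => x * h x := continuous_id.mul hh.continuous
    have integrable_h := hh.continuous.integrable_of_hasCompactSupport (μ := volume) hhc
    have integrable_mul := continuous_mul.integrable_of_hasCompactSupport (μ := volume) hhc.mul_left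
    simp only [smul_eq_mul]
    rw [← integral_mul_superlevelPairing hvm φ integrable_h integrable_mul,
      ← weakPairing_eq_integral φ (fun _ _ => rfl) (fun _ _ => rfl)]
    exact hsol.weakPairing_eq_zero hvm hv henergy (hh.of_le (by simp)) hhc
      (hasDerivAt_integral_Iio hh.continuous integrable_h)
      (hasDerivAt_integral_Iio continuous_mul integrable_mul) φ
  by_contra hne
  obtain ⟨b, hξb, hsub⟩ := mem_nhdsGT_iff_exists_Ioo_subset.1
    ((tendsto_superlevelPairing hvm φ ξ).eventually_ne hne)
  have volume_eq_zero : volume (Ioo ξ b) = 0 :=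
    measure_mono_null (fun x hx => hsub hx) (ae_iff.1 ae_eq_zero)
  rw [Real.volume_Ioo, ENNReal.ofReal_eq_zero] at volume_eq_zero
  linarith [show ξ < b from hξb]

end KineticFormulation

section Characteristics

open Filter Topology
open scoped Convolution ContDiff

variable {E : Type*} [NormedAddCommGroup E] [NormedSpace ℝ E] {f g : E → ℝ} {w : E}
  {Ω : Opens E} {U : Set E}

theorem exists_testFunction_eq_translate (hg : ContDiff ℝ ∞ g) (hgc : HasCompactSupport g)
    (hΩ : ∀ z ∈ tsupport g, z + w ∈ Ω) : ∃ φ : 𝓓(Ω, ℝ), ⇑φ = fun z => g (z - w) :=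
  ⟨{  toFun := g ∘ Homeomorph.subRight w
      contDiff' := hg.comp (contDiff_id.sub contDiff_const)
      hasCompactSupport' := hgc.comp_homeomorph _
      tsupport_subset' := fun z hz => by
        rw [tsupport_comp_eq_preimage] at hz
        simpa using hΩ _ hz }, rfl⟩

variable [FiniteDimensional ℝ E] [MeasureSpace E] [BorelSpace E]
  [(volume : Measure E).IsAddHaarMeasure]

theorem hasDerivAt_integral_mul_translate (hf : LocallyIntegrable f) (hg : ContDiff ℝ 1 g)
    (hgc : HasCompactSupport g) (w : E) (θ : ℝ) :
    HasDerivAt (fun θ : ℝ => ∫ z, f z * g (z - θ • w))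
      (-∫ z, f z * fderiv ℝ g (z - θ • w) w) θ := by
  let ψ : E → ℝ := fun y => g (-y)
  have contDiff_ψ : ContDiff ℝ 1 ψ := hg.comp contDiff_neg
  have hasCompactSupport_ψ : HasCompactSupport ψ := hgc.comp_homeomorph (Homeomorph.neg E)
  have fderiv_ψ (y : E) : fderiv ℝ ψ y w = -fderiv ℝ g (-y) w := by
    have : HasFDerivAt ψ _ y :=
      (hg.differentiable one_ne_zero (-y)).hasFDerivAt.comp y (hasFDerivAt_id y).neg
    simp [this.fderiv]
  have differentiable_convolution : Differentiable ℝ (f ⋆ ψ) :=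
    (hasCompactSupport_ψ.contDiff_convolution_right (n := 1) _ hf contDiff_ψ).differentiable
      one_ne_zero
  have hasDerivAt_smul : HasDerivAt (fun θ : ℝ => θ • w) w θ := by
    simpa using (hasDerivAt_id θ).smul_const w
  have := (differentiable_convolution (θ • w)).hasFDerivAt.comp_hasDerivAt θ hasDerivAt_smul
  rw [fderiv_convolution_apply hf contDiff_ψ hasCompactSupport_ψ] at this
  refine (this.congr_of_eventuallyEq (.of_forall fun θ => ?_)).congr_deriv ?_
  · simp [convolution_def, ψ]
  · simp [convolution_def, fderiv_ψ, integral_neg]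

/-- Along `θ ↦ z + θ w` the integral `∫ f(z) g(z - θ w) dz` has derivative zero, because each
`g(· - θ w)` is an admissible test function. -/
theorem integral_mul_translate_eq (hf : LocallyIntegrable f)
    (hfw : ∀ φ : 𝓓(Ω, ℝ), ∫ z, f z * fderiv ℝ φ z w = 0) (hg : ContDiff ℝ ∞ g)
    (hgc : HasCompactSupport g)
    (hΩ : ∀ z ∈ tsupport g, ∀ θ ∈ Icc (0 : ℝ) 1, z + θ • w ∈ Ω) :
    ∫ z, f z * g (z - w) = ∫ z, f z * g z := by
  have hasDerivAt_zero (θ : ℝ) (hθ : θ ∈ Icc (0 : ℝ) 1) :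
      HasDerivAt (fun θ : ℝ => ∫ z, f z * g (z - θ • w)) 0 θ := by
    refine (hasDerivAt_integral_mul_translate hf (hg.of_le (by simp)) hgc w θ).congr_deriv ?_
    obtain ⟨φ, hφ⟩ := exists_testFunction_eq_translate hg hgc fun z hz => hΩ z hz θ hθ
    have := hfw φ
    simp only [hφ, fderiv_comp_sub] at this
    rw [this, neg_zero]
  have := constant_of_has_deriv_right_zero
    (fun θ hθ => (hasDerivAt_zero θ hθ).continuousAt.continuousWithinAt)
    (fun θ hθ => (hasDerivAt_zero θ (Ico_subset_Icc_self hθ)).hasDerivWithinAt)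
    1 (right_mem_Icc.2 zero_le_one)
  simpa using this

theorem ae_translate_eq_of_integral_mul_fderiv_eq_zero (hf : LocallyIntegrable f)
    (hfw : ∀ φ : 𝓓(Ω, ℝ), ∫ z, f z * fderiv ℝ φ z w = 0) (hU : IsOpen U)
    (hUΩ : ∀ z ∈ U, ∀ θ ∈ Icc (0 : ℝ) 1, z + θ • w ∈ Ω) : ∀ᵐ z, z ∈ U → f (z + w) = f z := by
  have hf' : LocallyIntegrable fun z => f (z + w) := by
    refine (locallyIntegrable_map_homeomorph (Homeomorph.addRight w)).1 ?_
    rwa [Homeomorph.coe_addRight, map_add_right_eq_self]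
  have ae_sub_eq_zero : ∀ᵐ z, z ∈ U → f (z + w) - f z = 0 := by
    refine hU.ae_eq_zero_of_integral_contDiff_smul_eq_zero
      ((hf'.sub hf).locallyIntegrableOn U) fun g hg hgc hgU => ?_
    calc ∫ z, g z • (f (z + w) - f z)
        = (∫ z, g z * f (z + w)) - ∫ z, g z * f z := by
          simp only [smul_eq_mul, mul_sub]
          exact integral_sub (hf'.integrable_smul_left_of_hasCompactSupport hg.continuous hgc)
            (hf.integrable_smul_left_of_hasCompactSupport hg.continuous hgc)
      _ = (∫ z, f z * g (z - w)) - ∫ z, f z * g z := by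
          rw [← integral_add_right_eq_self (fun z => f z * g (z - w)) w]
          simp only [add_sub_cancel_right, mul_comm]
      _ = 0 := by
          rw [integral_mul_translate_eq hf hfw hg hgc fun z hz => hUΩ z (hgU hz), sub_self]
  filter_upwards [ae_sub_eq_zero] with z hz hzU using sub_eq_zero.1 (hz hzU)

theorem IsKineticSolution.ae_lt_iff_lt_add {Ω : Opens (ℝ × ℝ)} {v : ℝ × ℝ → ℝ} {U : Set (ℝ × ℝ)}
    (hkin : IsKineticSolution Ω v) (hv : Measurable v) {ξ τ : ℝ} (hU : IsOpen U)
    (hUΩ : ∀ z ∈ U, ∀ θ ∈ Icc (0 : ℝ) 1, z + θ • (τ, ξ * τ) ∈ Ω) :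
    ∀ᵐ z, z ∈ U → (ξ < v z ↔ ξ < v (z + (τ, ξ * τ))) := by
  let f : ℝ × ℝ → ℝ := {z | ξ < v z}.indicator 1
  have measurableSet_superlevel : MeasurableSet {z | ξ < v z} :=
    measurableSet_lt measurable_const hv
  have locallyIntegrable_f : LocallyIntegrable f :=
    (locallyIntegrable_const 1).indicator measurableSet_superlevel
  have integral_eq_zero (φ : 𝓓(Ω, ℝ)) : ∫ z, f z * fderiv ℝ φ z (τ, ξ * τ) = 0 := by
    calc ∫ z, f z * fderiv ℝ φ z (τ, ξ * τ)
        = ∫ z, {z | ξ < v z}.indicator (fun z => τ * fderiv ℝ φ z (1, ξ)) z := by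
          refine integral_congr_ae (.of_forall fun z => ?_)
          have : ((τ, ξ * τ) : ℝ × ℝ) = τ • (1, ξ) := by simp [mul_comm]
          simp only [this, map_smul, f, indicator]
          split_ifs <;> simp
      _ = 0 := by
          rw [integral_indicator measurableSet_superlevel, integral_const_mul]
          exact mul_eq_zero_of_right τ (hkin φ ξ)
  filter_upwards [ae_translate_eq_of_integral_mul_fderiv_eq_zero locallyIntegrable_f
    integral_eq_zero hU hUΩ] with z hz hzU
  have := hz hzU
  by_cases h₁ : ξ < v z <;> by_cases h₂ : ξ < v (z + (τ, ξ * τ)) <;>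
    simp [f, h₁, h₂] at this ⊢

end Characteristics

/-- If almost every point of a non-null set `A` is moved into `B` by each translation in `R`,
then by Fubini some point of `A` is moved into `B` by almost all of them. -/
theorem measure_le_of_ae_add_mem {G : Type*} [MeasurableSpace G] [AddGroup G] [MeasurableAdd₂ G]
    {μ : Measure G} [SFinite μ] [μ.IsAddLeftInvariant] {A B R : Set G} (hA : MeasurableSet A)
    (hB : MeasurableSet B) (hR : MeasurableSet R) (hA₀ : μ A ≠ 0)
    (h : ∀ w ∈ R, ∀ᵐ z ∂μ, z ∈ A → z + w ∈ B) : μ R ≤ μ B := by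
  have measurableSet_imp : MeasurableSet {p : G × G | p.1 ∈ R → p.2 ∈ A → p.2 + p.1 ∈ B} :=
    (measurable_fst hR).imp ((measurable_snd hA).imp ((measurable_snd.add measurable_fst) hB))
  have ae_ae : ∀ᵐ z ∂μ, ∀ᵐ w ∂μ, w ∈ R → z ∈ A → z + w ∈ B :=
    (Measure.ae_ae_comm measurableSet_imp).1
      (.of_forall fun w => Filter.eventually_imp_distrib_left.2 (h w))
  obtain ⟨z, hzA, hz⟩ := ((frequently_ae_mem_iff.2 hA₀).and_eventually ae_ae).exists
  calc μ R ≤ μ ((z + ·) ⁻¹' B) := by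
        refine measure_mono_ae ?_
        filter_upwards [hz] with w hw hwR using hw hwR hzA
    _ = μ B := measure_preimage_add μ z B

section LocalBound

open Filter Topology Metric

theorem eventually_measure_le_abs_lt {X : Type*} [MeasurableSpace X] {μ : Measure X} {f : X → ℝ}
    (hf : MemLp f 2 μ) {c : ℝ} (hc : 0 < c) :
    ∀ᶠ M : ℝ in atTop, μ {x | M ≤ |f x|} < ENNReal.ofReal (c / M) := by
  set N := ∫⁻ x, ‖f x‖ₑ ^ 2 ∂μ
  have N_ne_top : N ≠ ⊤ := by
    simpa using (lintegral_rpow_enorm_lt_top_of_eLpNorm_lt_top (by simp) (by simp) hf.2).ne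
  filter_upwards [eventually_gt_atTop 0, eventually_gt_atTop (N.toReal / c)] with M hM hNM
  calc μ {x | M ≤ |f x|} = μ {x | ENNReal.ofReal (M ^ 2) ≤ ‖f x‖ₑ ^ 2} := by
        congr with x
        rw [Real.enorm_eq_ofReal_abs, ← ENNReal.ofReal_pow (abs_nonneg _),
          ENNReal.ofReal_le_ofReal_iff (by positivity), pow_le_pow_iff_left₀ hM.le (abs_nonneg _)
            two_ne_zero]
    _ ≤ N / ENNReal.ofReal (M ^ 2) :=
        meas_ge_le_lintegral_div (hf.1.aemeasurable.enorm.pow_const 2)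
          (by simpa using hM.ne') ENNReal.ofReal_ne_top
    _ = ENNReal.ofReal (N.toReal / M ^ 2) := by
        rw [ENNReal.ofReal_div_of_pos (by positivity), ENNReal.ofReal_toReal N_ne_top]
    _ < ENNReal.ofReal (c / M) := by
        refine (ENNReal.ofReal_lt_ofReal_iff (by positivity)).2 ?_
        rw [div_lt_iff₀ hc] at hNM
        rw [div_lt_div_iff₀ (by positivity) hM]
        nlinarith

variable {Ω : Opens (ℝ × ℝ)} {v : ℝ × ℝ → ℝ} {K A B R : Set (ℝ × ℝ)} {ρ M : ℝ}

theorem add_smul_mem_thickening {E : Type*} [SeminormedAddCommGroup E] [NormedSpace ℝ E]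
    {K : Set E} {ρ : ℝ} {z w : E} (hz : z ∈ thickening ρ K) (hw : ‖w‖ ≤ ρ) {θ : ℝ}
    (hθ : θ ∈ Icc (0 : ℝ) 1) : z + θ • w ∈ thickening (ρ + ρ) K := by
  obtain ⟨x, hx, hzx⟩ := mem_thickening_iff.1 hz
  refine mem_thickening_iff.2 ⟨x, hx, ?_⟩
  calc dist (z + θ • w) x ≤ dist (z + θ • w) z + dist z x := dist_triangle _ _ _
    _ = θ * ‖w‖ + dist z x := by
        rw [dist_eq_norm, add_sub_cancel_left, norm_smul, Real.norm_of_nonneg hθ.1]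
    _ < ρ + ρ := add_lt_add_of_le_of_lt
        ((mul_le_of_le_one_left (norm_nonneg w) hθ.2).trans hw) hzx

/-- A point `z` of `A` spreads the condition on `v z` over its translates by `R`, since `{v > ξ}`
is invariant under the vectors of slope `ξ`. -/
theorem IsKineticSolution.volume_le_of_forall_lt_iff (hkin : IsKineticSolution Ω v)
    (hv : Measurable v) (hρ : 0 < ρ) (hKΩ : thickening (ρ + ρ) K ⊆ Ω) (hA : MeasurableSet A)
    (hAK : A ⊆ K) (hA₀ : volume A ≠ 0) (hB : MeasurableSet B) (hR : MeasurableSet R)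
    (hRρ : ∀ w ∈ R, w.1 ≠ 0 ∧ ‖w‖ ≤ ρ)
    (hAB : ∀ w ∈ R, ∀ z ∈ A, ∀ z', (w.2 / w.1 < v z ↔ w.2 / w.1 < v z') → z' ∈ B) :
    volume R ≤ volume (B ∩ thickening (ρ + ρ) K) := by
  refine measure_le_of_ae_add_mem hA (hB.inter isOpen_thickening.measurableSet) hR hA₀
    fun w hw => ?_
  obtain ⟨hw₀, hwρ⟩ := hRρ w hw
  have w_eq : w = (w.1, w.2 / w.1 * w.1) := by rw [div_mul_cancel₀ _ hw₀]
  have mem_thickening (z) (hz : z ∈ thickening ρ K) (θ : ℝ) (hθ : θ ∈ Icc (0 : ℝ) 1) :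
      z + θ • w ∈ thickening (ρ + ρ) K := add_smul_mem_thickening hz hwρ hθ
  have ae_lt_iff := hkin.ae_lt_iff_lt_add hv (ξ := w.2 / w.1) (τ := w.1)
    (isOpen_thickening (δ := ρ) (E := K)) (by
      rw [← w_eq]; exact fun z hz θ hθ => hKΩ (mem_thickening z hz θ hθ))
  rw [← w_eq] at ae_lt_iff
  filter_upwards [ae_lt_iff] with z hz hzA
  have z_mem := self_subset_thickening hρ K (hAK hzA)
  exact ⟨hAB w hw z hzA _ (hz z_mem), by simpa using mem_thickening z z_mem 1 (by simp)⟩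

theorem volume_Ioo_prod_Ioo (hρ : 0 < ρ) (hM : 0 < M) {a b : ℝ} (hab : b - a = ρ / 6) :
    volume (Ioo (ρ / (3 * M)) (ρ / (2 * M)) ×ˢ Ioo a b)
      = ENNReal.ofReal (ρ ^ 2 / 36 / M) := by
  rw [Measure.volume_eq_prod, Measure.prod_prod, Real.volume_Ioo, Real.volume_Ioo, hab,
    ← ENNReal.ofReal_mul' (by positivity)]
  congr 1
  field_simp
  norm_num

theorem slope_mem_Ioo (hρ : 0 < ρ) (hM : 1 ≤ M) {τ σ : ℝ}
    (hτ : τ ∈ Ioo (ρ / (3 * M)) (ρ / (2 * M))) (hσ : σ ∈ Ioo (ρ / 2) (2 * ρ / 3)) :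
    0 < τ ∧ τ ≤ ρ ∧ σ / τ ∈ Ioo M (2 * M) := by
  have hτ₀ : 0 < τ := lt_trans (by positivity) hτ.1
  have h₁ := (div_lt_iff₀ (by positivity)).1 hτ.1
  have h₂ := (lt_div_iff₀ (by positivity)).1 hτ.2
  refine ⟨hτ₀, by nlinarith, (lt_div_iff₀ hτ₀).2 ?_, (div_lt_iff₀ hτ₀).2 ?_⟩ <;>
    linarith [hσ.1, hσ.2]

/-- If `v > 2M` on a non-null subset of `K`, then the characteristics with speeds in `(M, 2M)`
carry the bound `v > M` to a set of area at least `ρ² / (36 M)`. -/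
theorem IsKineticSolution.ae_le_two_mul (hkin : IsKineticSolution Ω v) (hv : Measurable v)
    (hK : MeasurableSet K) (hρ : 0 < ρ) (hKΩ : thickening (ρ + ρ) K ⊆ Ω) (hM : 1 ≤ M)
    (hlt : volume ({z | M ≤ |v z|} ∩ thickening (ρ + ρ) K) < ENNReal.ofReal (ρ ^ 2 / 36 / M)) :
    ∀ᵐ z, z ∈ K → v z ≤ 2 * M := by
  suffices volume (K ∩ {z | 2 * M < v z}) = 0 by
    filter_upwards [measure_eq_zero_iff_ae_notMem.1 this] with z hz hzK
    exact not_lt.1 fun h => hz ⟨hzK, h⟩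
  by_contra hA₀
  refine hlt.not_ge ?_
  rw [← volume_Ioo_prod_Ioo hρ (by linarith) (show 2 * ρ / 3 - ρ / 2 = ρ / 6 by ring)]
  refine hkin.volume_le_of_forall_lt_iff hv hρ hKΩ (hK.inter (measurableSet_lt measurable_const hv))
    inter_subset_left hA₀ (measurableSet_le measurable_const hv.abs)
    (measurableSet_Ioo.prod measurableSet_Ioo) ?_ ?_
  · rintro ⟨τ, σ⟩ ⟨hτ, hσ⟩
    obtain ⟨hτ₀, hτρ, -⟩ := slope_mem_Ioo hρ hM hτ hσ
    refine ⟨hτ₀.ne', max_le ?_ ?_⟩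
    · rwa [Real.norm_of_nonneg hτ₀.le]
    · exact abs_le.2 ⟨by linarith [hσ.1], by linarith [hσ.2]⟩
  · rintro ⟨τ, σ⟩ ⟨hτ, hσ⟩ z hz z' hz'
    obtain ⟨-, -, hlow, hup⟩ := slope_mem_Ioo hρ hM hτ hσ
    exact (hlow.trans (hz'.1 (hup.trans hz.2))).le.trans (le_abs_self _)

theorem IsKineticSolution.ae_neg_two_mul_le (hkin : IsKineticSolution Ω v) (hv : Measurable v)
    (hK : MeasurableSet K) (hρ : 0 < ρ) (hKΩ : thickening (ρ + ρ) K ⊆ Ω) (hM : 1 ≤ M)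
    (hlt : volume ({z | M ≤ |v z|} ∩ thickening (ρ + ρ) K) < ENNReal.ofReal (ρ ^ 2 / 36 / M)) :
    ∀ᵐ z, z ∈ K → -(2 * M) ≤ v z := by
  suffices volume (K ∩ {z | v z < -(2 * M)}) = 0 by
    filter_upwards [measure_eq_zero_iff_ae_notMem.1 this] with z hz hzK
    exact not_lt.1 fun h => hz ⟨hzK, h⟩
  by_contra hA₀
  refine hlt.not_ge ?_
  rw [← volume_Ioo_prod_Ioo hρ (by linarith) (show -(ρ / 2) - -(2 * ρ / 3) = ρ / 6 by ring)]
  refine hkin.volume_le_of_forall_lt_iff hv hρ hKΩ (hK.inter (measurableSet_lt hv measurable_const))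
    inter_subset_left hA₀ (measurableSet_le measurable_const hv.abs)
    (measurableSet_Ioo.prod measurableSet_Ioo) ?_ ?_
  · rintro ⟨τ, σ⟩ ⟨hτ, hσ⟩
    obtain ⟨hτ₀, hτρ, -⟩ := slope_mem_Ioo hρ hM hτ (neg_mem_Ioo_iff.2 hσ)
    refine ⟨hτ₀.ne', max_le ?_ ?_⟩
    · rwa [Real.norm_of_nonneg hτ₀.le]
    · exact abs_le.2 ⟨by linarith [hσ.1], by linarith [hσ.2]⟩
  · rintro ⟨τ, σ⟩ ⟨hτ, hσ⟩ z ⟨-, hz⟩ z' hz'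
    obtain ⟨-, -, hlow, hup⟩ := slope_mem_Ioo hρ hM hτ (neg_mem_Ioo_iff.2 hσ)
    simp only [neg_div] at hlow hup hz'
    have hz_le : v z' ≤ σ / τ := not_lt.1 fun h => (hz'.2 h).not_ge (by linarith [hz.out])
    have lt_neg : M < -v z' := hlow.trans_le (neg_le_neg hz_le)
    exact lt_neg.le.trans (neg_le_abs _)

theorem MemLpLoc.mono_exponent {p q : ℝ≥0∞} (hv : MemLpLoc q Ω v) (hpq : p ≤ q) :
    MemLpLoc p Ω v := by
  intro K hK hKΩ
  have : IsFiniteMeasure (volume.restrict K) := isFiniteMeasure_restrict.2 hK.measure_ne_top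
  exact (hv K hK hKΩ).mono_exponent hpq

theorem IsKineticSolution.memLInftyLoc (hkin : IsKineticSolution Ω v) (hvm : Measurable v)
    (hv : MemLpLoc 2 Ω v) : MemLInftyLoc Ω v := by
  intro K hK hKΩ
  obtain ⟨r, hr, hKr⟩ := hK.exists_cthickening_subset_open Ω.isOpen hKΩ
  obtain ⟨ρ, hρ, rfl⟩ : ∃ ρ > 0, ρ + ρ = r := ⟨r / 2, half_pos hr, add_halves r⟩
  have subset_thickening : thickening (ρ + ρ) K ⊆ cthickening (ρ + ρ) K :=
    thickening_subset_cthickening _ _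
  obtain ⟨M, hMlt, hM⟩ := ((eventually_measure_le_abs_lt (hv _ hK.cthickening hKr)
    (show 0 < ρ ^ 2 / 36 by positivity)).and (eventually_ge_atTop 1)).exists
  have volume_lt : volume ({z | M ≤ |v z|} ∩ thickening (ρ + ρ) K)
      < ENNReal.ofReal (ρ ^ 2 / 36 / M) := by
    refine lt_of_le_of_lt ?_ hMlt
    rw [Measure.restrict_apply (measurableSet_le measurable_const hvm.abs)]
    exact measure_mono (inter_subset_inter_right _ subset_thickening)
  refine memLp_top_of_bound hvm.aestronglyMeasurable (2 * M) ?_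
  refine (ae_restrict_iff' hK.measurableSet).2 ?_
  filter_upwards [
    hkin.ae_le_two_mul hvm hK.measurableSet hρ (subset_thickening.trans hKr) hM volume_lt,
    hkin.ae_neg_two_mul_le hvm hK.measurableSet hρ (subset_thickening.trans hKr) hM volume_lt]
    with z hz_le hle_z hzK
  exact abs_le.2 ⟨hle_z hzK, hz_le hzK⟩

end LocalBound

section Entropies

theorem isEntropyPair_sq_cube : IsEntropyPair (fun x => x ^ 2 / 2) (fun x => x ^ 3 / 3) where
  entropy_lipschitz := ContDiff.locallyLipschitz (by fun_prop)
  flux_lipschitz := ContDiff.locallyLipschitz (by fun_prop)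
  deriv_flux := Filter.Eventually.of_forall fun w => by
    simp only [deriv_div_const, deriv_pow_field]
    norm_num
    ring

theorem absolutelyContinuousOnInterval_of_locallyLipschitz {f : ℝ → ℝ} (hf : LocallyLipschitz f)
    (a b : ℝ) : AbsolutelyContinuousOnInterval f a b :=
  have ⟨_, hC⟩ := (hf.locallyLipschitzOn (s := uIcc a b)).exists_lipschitzOnWith_of_compact
    isCompact_uIcc
  hC.absolutelyContinuousOnInterval

theorem integrable_indicator_deriv_of_locallyLipschitz {f : ℝ → ℝ} (hf : LocallyLipschitz f)
    {a b : ℝ} (hab : a ≤ b) : Integrable ((Ioc a b).indicator (deriv f)) :=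
  ((intervalIntegrable_iff_integrableOn_Ioc_of_le hab).1
    (absolutelyContinuousOnInterval_of_locallyLipschitz hf
      a b).intervalIntegrable_deriv).integrable_indicator measurableSet_Ioc

theorem eq_add_setIntegral_Iio_indicator_deriv {f : ℝ → ℝ} (hf : LocallyLipschitz f)
    {a b x : ℝ} (hx : x ∈ Icc a b) :
    f x = f a + ∫ ξ in Iio x, (Ioc a b).indicator (deriv f) ξ := by
  have Iic_inter_Ioc : Iic x ∩ Ioc a b = Ioc a x := by
    rw [inter_comm, Ioc_inter_Iic, min_eq_right hx.2]
  rw [← integral_Iic_eq_integral_Iio, setIntegral_indicator measurableSet_Ioc, Iic_inter_Ioc,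
    ← intervalIntegral.integral_of_le hx.1,
    (absolutelyContinuousOnInterval_of_locallyLipschitz hf a x).integral_deriv_eq_sub,
    add_sub_cancel]

theorem MemLInftyLoc.exists_ae_abs_le {Ω : Opens (ℝ × ℝ)} {v : ℝ × ℝ → ℝ}
    (hv : MemLInftyLoc Ω v) {K : Set (ℝ × ℝ)} (hK : IsCompact K) (hKΩ : K ⊆ Ω) :
    ∃ M ≥ 0, ∀ᵐ z ∂volume.restrict K, |v z| ≤ M := by
  have essSup_lt_top : eLpNormEssSup v (volume.restrict K) < ⊤ := by
    simpa only [eLpNorm_exponent_top] using (hv K hK hKΩ).2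
  refine ⟨(eLpNormEssSup v (volume.restrict K)).toReal, ENNReal.toReal_nonneg, ?_⟩
  filter_upwards [enorm_ae_le_eLpNormEssSup v (volume.restrict K)] with z hz
  rwa [← ENNReal.ofReal_le_iff_le_toReal essSup_lt_top.ne, ← Real.norm_eq_abs, ofReal_norm]

theorem MemLInftyLoc.locallyIntegrableOn_comp {Ω : Opens (ℝ × ℝ)} {v : ℝ × ℝ → ℝ}
    (hv : MemLInftyLoc Ω v) {f : ℝ → ℝ} (hf : Continuous f) :
    LocallyIntegrableOn (fun z => f (v z)) (Ω : Set (ℝ × ℝ)) := by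
  refine (locallyIntegrableOn_iff Ω.isOpen.isLocallyClosed).2 fun K hKΩ hK => ?_
  obtain ⟨M, -, hM⟩ := hv.exists_ae_abs_le hK hKΩ
  obtain ⟨C, hC⟩ := (isCompact_Icc (a := -M) (b := M)).exists_bound_of_continuousOn hf.continuousOn
  have : IsFiniteMeasure (volume.restrict K) := isFiniteMeasure_restrict.2 hK.measure_lt_top.ne
  refine Integrable.of_bound (hf.comp_aestronglyMeasurable (hv K hK hKΩ).1) C ?_
  filter_upwards [hM] with z hz using hC _ (abs_le.1 hz)

theorem IsEntropyPair.exists_eq_add_setIntegral_Iio {η q : ℝ → ℝ} (hηq : IsEntropyPair η q)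
    {M : ℝ} (hM : 0 ≤ M) :
    ∃ g : ℝ → ℝ, Integrable g ∧ Integrable (fun ξ => ξ * g ξ) ∧ ∀ x, |x| ≤ M →
      η x = η (-M) + ∫ ξ in Iio x, g ξ ∧ q x = q (-M) + ∫ ξ in Iio x, ξ * g ξ := by
  have hM' : -M ≤ M := neg_le_self hM
  have deriv_flux : (Ioc (-M) M).indicator (deriv q)
      =ᵐ[volume] fun ξ => ξ * (Ioc (-M) M).indicator (deriv η) ξ := by
    filter_upwards [hηq.deriv_flux] with ξ h
    simp only [indicator_apply, h, mul_ite, mul_zero]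
  refine ⟨(Ioc (-M) M).indicator (deriv η),
    integrable_indicator_deriv_of_locallyLipschitz hηq.entropy_lipschitz hM',
    (integrable_indicator_deriv_of_locallyLipschitz hηq.flux_lipschitz hM').congr deriv_flux,
    fun x hx => ⟨eq_add_setIntegral_Iio_indicator_deriv hηq.entropy_lipschitz (abs_le.1 hx), ?_⟩⟩
  rw [← integral_congr_ae (ae_restrict_of_ae deriv_flux)]
  exact eq_add_setIntegral_Iio_indicator_deriv hηq.flux_lipschitz (abs_le.1 hx)

theorem IsKineticSolution.weakPairing_entropyPair_eq_zero {Ω : Opens (ℝ × ℝ)} {v : ℝ × ℝ → ℝ}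
    (hkin : IsKineticSolution Ω v) (hvm : Measurable v) (hbdd : MemLInftyLoc Ω v) {η q : ℝ → ℝ}
    (hηq : IsEntropyPair η q) (φ : 𝓓(Ω, ℝ)) :
    weakPairing Ω (fun z => η (v z)) (fun z => q (v z)) φ = 0 := by
  obtain ⟨M, hM, abs_le_M⟩ := hbdd.exists_ae_abs_le φ.hasCompactSupport φ.tsupport_subset
  obtain ⟨g, ig, ig', representation⟩ := hηq.exists_eq_add_setIntegral_Iio hM
  have it := integrable_fderiv_testFunction φ (1, 0)
  have is := integrable_fderiv_testFunction φ (0, 1)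
  have iconst : Integrable fun z =>
      η (-M) * fderiv ℝ φ z (1, 0) + q (-M) * fderiv ℝ φ z (0, 1) :=
    (it.const_mul _).add (is.const_mul _)
  have ilayer : Integrable fun z => (∫ ξ in Iio (v z), g ξ) * fderiv ℝ φ z (1, 0)
      + (∫ ξ in Iio (v z), ξ * g ξ) * fderiv ℝ φ z (0, 1) :=
    (integral_mul_superlevelIntegral hvm it ig).1.add
      (integral_mul_superlevelIntegral hvm is ig').1
  have hφ : ContDiff ℝ 1 φ := φ.contDiff.of_le (by simp)
  rw [weakPairing_eq_integral φ (fun _ _ => rfl) (fun _ _ => rfl)]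
  calc ∫ z, (η (v z) * fderiv ℝ φ z (1, 0) + q (v z) * fderiv ℝ φ z (0, 1))
      = ∫ z, ((η (-M) * fderiv ℝ φ z (1, 0) + q (-M) * fderiv ℝ φ z (0, 1)) +
          ((∫ ξ in Iio (v z), g ξ) * fderiv ℝ φ z (1, 0)
            + (∫ ξ in Iio (v z), ξ * g ξ) * fderiv ℝ φ z (0, 1))) := by
        refine integral_congr_ae ?_
        filter_upwards [(ae_restrict_iff' (isClosed_tsupport φ).measurableSet).1 abs_le_M]
          with z hz
        by_cases hzK : z ∈ tsupport φ
        · rw [(representation _ (hz hzK)).1, (representation _ (hz hzK)).2]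
          ring
        · simp only [fderiv_eq_zero_of_notMem_tsupport hzK, zero_apply, mul_zero, add_zero]
    _ = 0 := by
        rw [integral_add iconst ilayer, integral_mul_superlevelPairing hvm φ ig ig',
          integral_add (it.const_mul _) (is.const_mul _), integral_const_mul, integral_const_mul,
          integral_fderiv_apply_eq_zero hφ φ.hasCompactSupport,
          integral_fderiv_apply_eq_zero hφ φ.hasCompactSupport]
        simp only [hkin φ, mul_zero, integral_zero, add_zero]

end Entropies

section Energy

theorem timeSpaceEnergy_eq_lintegral {v : ℝ × ℝ → ℝ} (hv : Measurable v) (I J : Set ℝ) :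
    timeSpaceEnergy I J v
      = ∫⁻ z in I ×ˢ J, ∫⁻ σ in J, ‖v z - v (z.1, σ)‖ₑ ^ 3 / ‖z.2 - σ‖ₑ ^ 2 := by
  have measurable_quotient : Measurable fun p : (ℝ × ℝ) × ℝ =>
      ‖v p.1 - v (p.1.1, p.2)‖ₑ ^ 3 / ‖p.1.2 - p.2‖ₑ ^ 2 := by fun_prop
  rw [timeSpaceEnergy, Measure.volume_eq_prod, setLIntegral_prod _
    measurable_quotient.lintegral_prod_right'.aemeasurable]
  refine lintegral_congr fun t => ?_
  exact setLIntegral_prod _ (by fun_prop)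

theorem spatialEnergy_eq_lintegral {v : ℝ × ℝ → ℝ} (hv : Measurable v) (K : Set (ℝ × ℝ)) (r : ℝ) :
    spatialEnergy v K r
      = ∫⁻ z in K, ∫⁻ y in Icc (-r) r, ‖v z - v (z - (0, y))‖ₑ ^ 3 / ‖y‖ₑ ^ 2 := by
  rw [lintegral_lintegral_swap (by fun_prop)]
  refine lintegral_congr fun y => ?_
  rw [increment, div_eq_mul_inv, ← lintegral_mul_const _ (by fun_prop)]
  simp only [enorm_sub_rev (v (_ - _)), div_eq_mul_inv]

theorem spatialEnergy_le_timeSpaceEnergy {v : ℝ × ℝ → ℝ} (hv : Measurable v) {I J : Set ℝ}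
    {K : Set (ℝ × ℝ)} {r : ℝ} (hK : K ⊆ I ×ˢ J)
    (hKr : ∀ z ∈ K, ∀ y ∈ Icc (-r) r, z.2 - y ∈ J) :
    spatialEnergy v K r ≤ timeSpaceEnergy I J v := by
  rw [timeSpaceEnergy_eq_lintegral hv, spatialEnergy_eq_lintegral hv]
  have measurable_quotient : Measurable fun p : (ℝ × ℝ) × ℝ =>
      ‖v p.1 - v (p.1.1, p.2)‖ₑ ^ 3 / ‖p.1.2 - p.2‖ₑ ^ 2 := by fun_prop
  refine (setLIntegral_mono measurable_quotient.lintegral_prod_right' fun z hz => ?_).trans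
    (lintegral_mono_set hK)
  calc ∫⁻ y in Icc (-r) r, ‖v z - v (z - (0, y))‖ₑ ^ 3 / ‖y‖ₑ ^ 2
      ≤ ∫⁻ y in (z.2 - ·) ⁻¹' J, ‖v z - v (z - (0, y))‖ₑ ^ 3 / ‖y‖ₑ ^ 2 :=
        lintegral_mono_set (hKr z hz)
    _ = ∫⁻ y in (z.2 - ·) ⁻¹' J, ‖v z - v (z.1, z.2 - y)‖ₑ ^ 3 / ‖z.2 - (z.2 - y)‖ₑ ^ 2 := by
        simp only [sub_sub_cancel, Prod.sub_def, sub_zero]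
    _ = ∫⁻ σ in J, ‖v z - v (z.1, σ)‖ₑ ^ 3 / ‖z.2 - σ‖ₑ ^ 2 :=
        (Measure.measurePreserving_sub_left volume z.2).setLIntegral_comp_preimage_emb
          (MeasurableEquiv.subLeft z.2).measurableEmbedding
          (fun σ => ‖v z - v (z.1, σ)‖ₑ ^ 3 / ‖z.2 - σ‖ₑ ^ 2) J

theorem timeSpaceEnergy_congr {I J : Opens ℝ} {v u : ℝ × ℝ → ℝ}
    (h : v =ᵐ[volume.restrict (rect I J : Set (ℝ × ℝ))] u) :
    timeSpaceEnergy I J v = timeSpaceEnergy I J u := by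
  have ae_rect : ∀ᵐ z ∂(volume.restrict (I : Set ℝ)).prod (volume.restrict (J : Set ℝ)),
      v z = u z := by
    rwa [Measure.prod_restrict]
  refine lintegral_congr_ae ?_
  filter_upwards [Measure.ae_ae_of_ae_prod ae_rect] with t ht
  rw [Measure.volume_eq_prod, ← Measure.prod_restrict]
  refine lintegral_congr_ae ?_
  filter_upwards [Measure.quasiMeasurePreserving_fst.ae ht,
    Measure.quasiMeasurePreserving_snd.ae ht] with p h₁ h₂
  rw [h₁, h₂]

end Energy

section Representatives

variable {Ω : Opens (ℝ × ℝ)} {v u : ℝ × ℝ → ℝ}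

theorem MemLpLoc.congr {p : ℝ≥0∞} (hv : MemLpLoc p Ω v)
    (h : v =ᵐ[volume.restrict (Ω : Set (ℝ × ℝ))] u) : MemLpLoc p Ω u :=
  fun K hK hKΩ => (hv K hK hKΩ).ae_eq (ae_restrict_of_ae_restrict_of_subset hKΩ h)

theorem WeakBalance.congr {a b a' b' : ℝ × ℝ → ℝ} (hab : WeakBalance Ω a b)
    (ha : a =ᵐ[volume.restrict (Ω : Set (ℝ × ℝ))] a')
    (hb : b =ᵐ[volume.restrict (Ω : Set (ℝ × ℝ))] b') : WeakBalance Ω a' b' where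
  locallyIntegrable_fst := hab.locallyIntegrable_fst.congr ha
  locallyIntegrable_snd := hab.locallyIntegrable_snd.congr hb
  eq_zero φ := by
    rw [← hab.eq_zero φ]
    refine integral_congr_ae ?_
    filter_upwards [ha, hb] with z hza hzb
    rw [hza, hzb]

theorem WeakBalance.weakBalanceLE {a b : ℝ × ℝ → ℝ} (hab : WeakBalance Ω a b) :
    WeakBalanceLE Ω a b where
  locallyIntegrable_fst := hab.locallyIntegrable_fst
  locallyIntegrable_snd := hab.locallyIntegrable_snd
  nonneg φ _ := (hab.eq_zero φ).ge

theorem IsBurgersSolution.congr (hv : IsBurgersSolution Ω v)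
    (h : v =ᵐ[volume.restrict (Ω : Set (ℝ × ℝ))] u) : IsBurgersSolution Ω u :=
  WeakBalance.congr hv h (h.fun_comp fun x => x ^ 2 / 2)

theorem increment_congr {K U : Set (ℝ × ℝ)} (h : v =ᵐ[volume.restrict U] u)
    (hK : MeasurableSet K) (hKU : K ⊆ U) {w : ℝ × ℝ} (hw : ∀ z ∈ K, z - w ∈ U) (n : ℕ) :
    increment v K n w = increment u K n w := by
  have ae_eq : ∀ᵐ z, z ∈ U → v z = u z := ae_imp_of_ae_restrict h
  refine setLIntegral_congr_fun_ae hK ?_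
  filter_upwards [ae_eq, (measurePreserving_sub_right volume w).quasiMeasurePreserving.ae ae_eq]
    with z h₁ h₂ hz
  rw [h₁ (hKU hz), h₂ (hw z hz)]

theorem sub_snd_mem_cthickening {K : Set (ℝ × ℝ)} {r y : ℝ} (hy : y ∈ Icc (-r) r) {z : ℝ × ℝ}
    (hz : z ∈ K) : z - (0, y) ∈ Metric.cthickening r K :=
  Metric.mem_cthickening_of_dist_le _ z r K hz (by simpa [Prod.norm_def] using abs_le.2 hy)

theorem HasLocallyFiniteEnergy.congr (hv : HasLocallyFiniteEnergy Ω v)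
    (h : v =ᵐ[volume.restrict (Ω : Set (ℝ × ℝ))] u) : HasLocallyFiniteEnergy Ω u := by
  intro K hK hKΩ
  obtain ⟨ρ, hρ, finite⟩ := hv K hK hKΩ
  obtain ⟨ρ', hρ', hρ'Ω⟩ := hK.exists_cthickening_subset_open Ω.isOpen hKΩ
  refine ⟨min ρ ρ', lt_min hρ hρ', ne_top_of_le_ne_top finite ?_⟩
  calc spatialEnergy u K (min ρ ρ') = spatialEnergy v K (min ρ ρ') := by
        refine setLIntegral_congr_fun measurableSet_Icc fun y hy => ?_
        simp only [increment_congr h hK.measurableSet hKΩ fun _ hz =>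
          hρ'Ω (Metric.cthickening_mono (min_le_right ρ ρ') K (sub_snd_mem_cthickening hy hz))]
    _ ≤ spatialEnergy v K ρ := lintegral_mono_set
        (Icc_subset_Icc (neg_le_neg (min_le_left ρ ρ')) (min_le_left ρ ρ'))

theorem hasLocallyFiniteEnergy_rect {I J : Opens ℝ} (hreg : timeSpaceEnergy I J v < ∞)
    (hv : AEStronglyMeasurable v (volume.restrict (rect I J : Set (ℝ × ℝ)))) :
    HasLocallyFiniteEnergy (rect I J) v := by
  have measurable_mk := hv.stronglyMeasurable_mk.measurable
  refine HasLocallyFiniteEnergy.congr (fun K hK hKΩ => ?_) hv.ae_eq_mk.symm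
  obtain ⟨r, hr, hrΩ⟩ := hK.exists_cthickening_subset_open (rect I J).isOpen hKΩ
  refine ⟨r, hr, ne_top_of_le_ne_top hreg.ne ?_⟩
  rw [timeSpaceEnergy_congr hv.ae_eq_mk]
  exact spatialEnergy_le_timeSpaceEnergy measurable_mk hKΩ fun _ hz _ hy =>
    (hrΩ (sub_snd_mem_cthickening hy hz)).2

end Representatives

theorem mainTheorem5_general {Ω : Opens (ℝ × ℝ)} {v : ℝ × ℝ → ℝ} (hv : MemLpLoc 3 Ω v)
    (hsol : IsBurgersSolution Ω v) (henergy : HasLocallyFiniteEnergy Ω v) :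
    MemLInftyLoc Ω v ∧
      ∀ η q, IsEntropyPair η q → WeakBalance Ω (fun z => η (v z)) (fun z => q (v z)) := by
  obtain ⟨u, hum, hvu⟩ : ∃ u, Measurable u ∧ v =ᵐ[volume.restrict (Ω : Set (ℝ × ℝ))] u :=
    have aesm := hsol.locallyIntegrable_fst.aestronglyMeasurable
    ⟨aesm.mk v, aesm.stronglyMeasurable_mk.measurable, aesm.ae_eq_mk⟩
  have hu : MemLpLoc 3 Ω u := hv.congr hvu
  have hkin : IsKineticSolution Ω u :=
    (hsol.congr hvu).isKineticSolution hum hu (henergy.congr hvu)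
  have hbdd : MemLInftyLoc Ω u := hkin.memLInftyLoc hum (hu.mono_exponent (by norm_num))
  refine ⟨MemLpLoc.congr hbdd hvu.symm, fun η q hηq => ?_⟩
  have balance : WeakBalance Ω (fun z => η (u z)) (fun z => q (u z)) :=
    ⟨hbdd.locallyIntegrableOn_comp hηq.entropy_lipschitz.continuous,
      hbdd.locallyIntegrableOn_comp hηq.flux_lipschitz.continuous,
      hkin.weakPairing_entropyPair_eq_zero hum hbdd hηq⟩
  exact balance.congr (hvu.symm.fun_comp η) (hvu.symm.fun_comp q)

theorem mainTheorem5 (I J : Opens ℝ)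
    (hI : (I : Set ℝ).OrdConnected) (hJ : (J : Set ℝ).OrdConnected)
    (v : ℝ × ℝ → ℝ)
    (hv4 : MemLp v 4 (volume.restrict (rect I J : Set (ℝ × ℝ))))
    (hburgers : IsBurgersSolution (rect I J) v)
    (hreg : timeSpaceEnergy I J v < ∞) :
    IsEntropySolution (rect I J) v ∧
      WeakBalance (rect I J) (fun z => v z ^ 2 / 2) (fun z => v z ^ 3 / 3) := by
  have hv : MemLpLoc 4 (rect I J) v := fun K _ hK =>
    hv4.mono_measure (Measure.restrict_mono hK le_rfl)
  obtain ⟨locallyBounded, balance⟩ := mainTheorem5_general (hv.mono_exponent (by norm_num))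
    hburgers (hasLocallyFiniteEnergy_rect hreg hv4.1)
  exact ⟨⟨locallyBounded, hburgers, fun η q hηq _ => (balance η q hηq).weakBalanceLE⟩,
    balance _ _ isEntropyPair_sq_cube⟩
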